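/- Fix a real order $m\ge 0$ and an integer $d\ge 0$, and let $$g_m(x)=\frac{\Gamma(2(m+1))}{2^{2m+1}\Gamma(m+1)^2}(1-x^2)^m,\qquad G_m(x)=\int_{-1}^x g_m(t)\,dt\qquad(-1\le x\le 1).$$ Let $M\subseteq[-\pi,\pi)$, $\boldsymbol R\subseteq\mathbb R^d$, $\Lambda=[-1+\delta,1-\delta]$ with $\delta>0$, and $\boldsymbol H=M\times\boldsymbol R\times\Lambda$, with elements $\boldsymbol\eta=(\mu,\boldsymbol\rho,\lambda)^T\in\mathbb R^{d+2}$. For $\boldsymbol\rho\in\boldsymbol R$ let $f_0(\cdot;\boldsymbol\rho)$ be a ($2\pi$-periodic) probability density on the circle. The extended sine-skewed (ESS) circular density of order $m$ is $$f(\theta;\boldsymbol\eta)=2f_0(\theta-\mu;\boldsymbol\rho)\,G_m(\lambda\sin(\theta-\mu)).$$ Let $\Theta_1,\Theta_2,\dots$ be i.i.d. on $[-\pi,\pi)$ with density $f(\cdot;\boldsymbol\eta_0)$, and let $\hat{\boldsymbol\eta}_n\in\boldsymbol H$ be a maximum likelihood estimator, i.e. almost surely $\ell_n(\hat{\boldsymbol\eta}_n)\ge\ell_n(\boldsymbol\eta)$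 for all $\boldsymbol\eta\in\boldsymbol H$, where $$\ell_n(\boldsymbol\eta)=\frac1n\sum_{i=1}^n\left[\log f_0(\Theta_i-\mu;\boldsymbol\rho)+\log\{2G_m(\lambda\sin(\Theta_i-\mu))\}\right].$$ Consider the following conditions. * **A1.** For every $\boldsymbol\rho\in\boldsymbol R$, $f_0(\cdot;\boldsymbol\rho)$ is continuous, unimodal on the circle, and symmetric about $0$. * **A2.** $\alpha_{0,1}(\boldsymbol\rho)=\int_{-\pi}^{\pi}\cos\theta\, f_0(\theta;\boldsymbol\rho)\,d\theta\in(0,1)$ for every $\boldsymbol\rho\in\boldsymbol R$, and $\sup_{\boldsymbol\rho\in\boldsymbol R}\alpha_{0,1}(\boldsymbol\rho)<1$. * **A3.** (i) $\boldsymbol H$ is compact and $\boldsymbol\eta_0\in\boldsymbol H$. (ii) $\boldsymbol H$ is convex and compact, and $\boldsymbol\eta_0$ is in the interior of $\boldsymbol H$. * **A4.** There are constants $Q,q>0$ with $\sup_{\boldsymbol\rho\in\boldsymbol R}f_0(\theta;\boldsymbol\rho)<Q$ and $\inf_{\boldsymbol\rho\in\boldsymbol R}f_0(\theta;\boldsymbol\rho)>q$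 for all $\theta\in[-\pi,\pi)$. * **A5.** The first three derivatives of $f_0(\theta-\mu;\boldsymbol\rho)$ with respect to $(\mu,\boldsymbol\rho)$ exist, are continuous, and are bounded over all $\theta$ and all $(\mu,\boldsymbol\rho)\in M\times\boldsymbol R$. * **A6.** The Fisher information matrix $\boldsymbol I(\boldsymbol\eta_0)=-E_{\boldsymbol\eta_0}\left[\frac{\partial^2}{\partial\boldsymbol\eta\,\partial\boldsymbol\eta^T}\log f(\Theta;\boldsymbol\eta)\Big|_{\boldsymbol\eta=\boldsymbol\eta_0}\right]$ is non-singular. * **A7.** If $\boldsymbol\eta_1,\boldsymbol\eta_2\in\boldsymbol H$ and $\boldsymbol\eta_1\ne\boldsymbol\eta_2$, then $f(\cdot;\boldsymbol\eta_1)\ne f(\cdot;\boldsymbol\eta_2)$. **Theorem.** If A1, A2, A3(i), A4 and A7 hold, and $f_0(\theta-\mu;\boldsymbol\rho)$ is continuous in $(\mu,\boldsymbol\rho)\in M\times\boldsymbol R$ for every $\theta$, then $\hat{\boldsymbol\eta}_n\to\boldsymbol\eta_0$ in probability as $n\to\infty$. If A1, A2, A3(ii), A4, A5, A6 and A7 hold,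 then $\sqrt n(\hat{\boldsymbol\eta}_n-\boldsymbol\eta_0)$ converges in distribution to $N(\boldsymbol 0,\boldsymbol I(\boldsymbol\eta_0)^{-1})$ as $n\to\infty$. -/

import Mathlib

open MeasureTheory ProbabilityTheory Filter Topology Set

noncomputable section

namespace ESS

/-- The parameter vector `η = (μ, ρ₁, …, ρ_d, λ)ᵀ`, in Euclidean space of dimension `d + 2`. -/
abbrev Param (d : ℕ) : Type := EuclideanSpace ℝ (Fin (d + 2))

/-- The shape parameter vector `ρ = (ρ₁, …, ρ_d)ᵀ`. -/
abbrev Shape (d : ℕ) : Type := EuclideanSpace ℝ (Fin d)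

/-- Location component `μ` of `η`. -/
def loc {d : ℕ} (η : Param d) : ℝ := η 0

/-- Shape component `ρ` of `η`. -/
def shape {d : ℕ} (η : Param d) : Shape d := WithLp.toLp 2 (fun i : Fin d => η i.castSucc.succ)

/-- Skewness component `λ` of `η`. -/
def skew {d : ℕ} (η : Param d) : ℝ := η (Fin.last (d + 1))

/-- The density `g_m` on `[-1, 1]`, for a real order `m ≥ 0`. -/
def g (m x : ℝ) : ℝ :=
  Real.Gamma (2 * (m + 1)) / ((2 : ℝ) ^ (2 * m + 1) * Real.Gamma (m + 1) ^ 2) * (1 - x ^ 2) ^ m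

/-- The distribution function `G_m` of `g_m` (used for arguments in `[-1, 1]`). -/
def G (m x : ℝ) : ℝ := ∫ t in (-1 : ℝ)..x, g m t

/-- The extended sine-skewed circular density of order `m` with base density `f₀`. -/
def density {d : ℕ} (m : ℝ) (f₀ : ℝ → Shape d → ℝ) (η : Param d) (θ : ℝ) : ℝ :=
  2 * f₀ (θ - loc η) (shape η) * G m (skew η * Real.sin (θ - loc η))

/-- The law on `[-π, π)` with density `density m f₀ η`. -/
def law {d : ℕ} (m : ℝ) (f₀ : ℝ → Shape d → ℝ) (η : Param d) : Measure ℝ :=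
  (volume.restrict (Ico (-Real.pi) Real.pi)).withDensity
    (fun θ => ENNReal.ofReal (density m f₀ η θ))

/-- The parameter space `H = M × R × [-1 + δ, 1 - δ]`. -/
def paramSpace {d : ℕ} (M : Set ℝ) (R : Set (Shape d)) (δ : ℝ) : Set (Param d) :=
  {η | loc η ∈ M ∧ shape η ∈ R ∧ skew η ∈ Icc (-1 + δ) (1 - δ)}

/-- A probability density on the circle, written as a `2π`-periodic function on the line. -/
structure IsCircularDensity (f : ℝ → ℝ) : Prop where
  nonneg : ∀ θ, 0 ≤ f θ
  periodic : Function.Periodic f (2 * Real.pi)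
  intervalIntegrable : IntervalIntegrable f volume (-Real.pi) Real.pi
  integral_eq_one : ∫ θ in (-Real.pi)..Real.pi, f θ = 1

/-- Unimodality on the circle: going once around from a mode `a`, the function first decreases
down to an antimode `b` and then increases back (both in the wide sense). -/
def CircularUnimodal (f : ℝ → ℝ) : Prop :=
  ∃ a b : ℝ, a ≤ b ∧ b ≤ a + 2 * Real.pi ∧
    AntitoneOn f (Icc a b) ∧ MonotoneOn f (Icc b (a + 2 * Real.pi))

/-- Condition A1: each base density is continuous, unimodal and symmetric about zero. -/
def CondA1 {d : ℕ} (f₀ : ℝ → Shape d → ℝ) (R : Set (Shape d)) : Prop :=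
  ∀ ρ ∈ R, Continuous (fun θ => f₀ θ ρ) ∧ CircularUnimodal (fun θ => f₀ θ ρ) ∧
    ∀ θ, f₀ (-θ) ρ = f₀ θ ρ

/-- The first cosine moment of the base density. -/
def cosMoment {d : ℕ} (f₀ : ℝ → Shape d → ℝ) (ρ : Shape d) : ℝ :=
  ∫ θ in (-Real.pi)..Real.pi, Real.cos θ * f₀ θ ρ

/-- Condition A2: the first cosine moment is in `(0, 1)`, and uniformly less than one. -/
def CondA2 {d : ℕ} (f₀ : ℝ → Shape d → ℝ) (R : Set (Shape d)) : Prop :=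
  (∀ ρ ∈ R, cosMoment f₀ ρ ∈ Ioo (0 : ℝ) 1) ∧ ∃ c < 1, ∀ ρ ∈ R, cosMoment f₀ ρ ≤ c

/-- Condition A4: the base densities are bounded, and bounded away from zero, uniformly. -/
def CondA4 {d : ℕ} (f₀ : ℝ → Shape d → ℝ) (R : Set (Shape d)) : Prop :=
  ∃ Q > 0, ∃ q > 0, ∀ θ ∈ Ico (-Real.pi) Real.pi, ∀ ρ ∈ R, q < f₀ θ ρ ∧ f₀ θ ρ < Q

/-- Condition A5: the derivatives of `(μ, ρ) ↦ f₀ (θ - μ; ρ)` up to the third order exist and are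
continuous on `M × R` for every `θ`, and are bounded uniformly in `θ`. -/
def CondA5 {d : ℕ} (f₀ : ℝ → Shape d → ℝ) (M : Set ℝ) (R : Set (Shape d)) : Prop :=
  (∀ θ : ℝ, ContDiffOn ℝ 3 (fun p : ℝ × Shape d => f₀ (θ - p.1) p.2) (M ×ˢ R)) ∧
    ∃ B : ℝ, ∀ θ : ℝ, ∀ p ∈ M ×ˢ R, ∀ k : ℕ, 1 ≤ k → k ≤ 3 →
      ‖iteratedFDerivWithin ℝ k (fun p : ℝ × Shape d => f₀ (θ - p.1) p.2) (M ×ˢ R) p‖ ≤ B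

/-- The Fisher information matrix `I(η) = -E_η [∂² log f(Θ; η) / ∂η ∂ηᵀ]`. -/
def fisherInfo {d : ℕ} (m : ℝ) (f₀ : ℝ → Shape d → ℝ) (η : Param d) :
    Matrix (Fin (d + 2)) (Fin (d + 2)) ℝ :=
  Matrix.of fun i j => -∫ θ, iteratedFDeriv ℝ 2
    (fun η' : Param d => Real.log (density m f₀ η' θ)) η
      ![EuclideanSpace.single i (1 : ℝ), EuclideanSpace.single j (1 : ℝ)] ∂(law m f₀ η)

/-- Condition A7: identifiability of the family over the parameter space `H`. -/
def CondA7 {d : ℕ} (m : ℝ) (f₀ : ℝ → Shape d → ℝ) (H : Set (Param d)) : Prop :=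
  ∀ η₁ ∈ H, ∀ η₂ ∈ H, η₁ ≠ η₂ → density m f₀ η₁ ≠ density m f₀ η₂

/-- The (normalized) log-likelihood of `η` for the observations `x 0, …, x (n - 1)`. -/
def logLik {d : ℕ} (m : ℝ) (f₀ : ℝ → Shape d → ℝ) (x : ℕ → ℝ) (n : ℕ) (η : Param d) : ℝ :=
  (1 / (n : ℝ)) * ∑ i ∈ Finset.range n,
    (Real.log (f₀ (x i - loc η) (shape η)) +
      Real.log (2 * G m (skew η * Real.sin (x i - loc η))))

/-- `e` is a maximum likelihood estimate over `H` from `x 0, …, x (n - 1)`. -/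
def IsMLE {d : ℕ} (m : ℝ) (f₀ : ℝ → Shape d → ℝ) (H : Set (Param d)) (x : ℕ → ℝ) (n : ℕ)
    (e : Param d) : Prop :=
  e ∈ H ∧ ∀ η ∈ H, logLik m f₀ x n η ≤ logLik m f₀ x n e

end ESS

end

/-! Consistency is Wald's argument. Condition A4 and the margin `δ` keep all the densities between
two positive constants, so `θ ↦ log f(θ; ·)` is a bounded random element of the separable Banach
space `C(H, ℝ)`. The Banach-valued strong law then makes the log-likelihood converge uniformly on
`H`, almost surely (`uniform_strong_law`). The limit is the expected log-density, whose only
maximizer is `η₀` by Gibbs' inequality and A7, so maximizers converge to `η₀` almost surely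
(`ae_tendsto_maximizer`, `ESS.ae_tendsto_mle`).

Asymptotic normality is Cramér's argument. Near the interior point `η₀` the log-density is `C³` with
derivatives bounded uniformly in `θ` (`ESS.exists_ball_log_density`). Once the estimator is near
`η₀` its score vanishes. Expanding the score at `η₀`, with a remainder controlled by third
derivatives, gives a linear equation for the error, in which the averaged Hessian tends to `-I`.
Differentiating `∫ exp F = 1` twice shows that the score is centred with covariance `I`. The central
limit theorem for `I⁻¹` times the score has limit covariance `I⁻¹ I I⁻¹ = I⁻¹`, and a Slutsky
argument passes this to the estimator (`tendstoInDistribution_of_linearized`).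

The Gamma constant in `g` is never evaluated. Symmetry gives every density the same mass `G m 1`,
which suffices for Gibbs' inequality; where mass one is needed, it follows because the sample law is
a probability measure. -/

/-! ### Uniform law of large numbers and consistency of maximizers. -/

/-- A map into `C(K, ℝ)`, `K` a compact metric space, is measurable as soon as all its
evaluations are. -/
theorem ContinuousMap.measurable_of_measurable_eval {K T : Type*} [MetricSpace K] [CompactSpace K]
    [MeasurableSpace T] [MeasurableSpace C(K, ℝ)] [BorelSpace C(K, ℝ)] {F : T → C(K, ℝ)}
    (hF : ∀ k, Measurable fun t => F t k) : Measurable F := by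
  obtain ⟨D, hDc, hDd⟩ := TopologicalSpace.exists_countable_dense K
  have hball : ∀ (f : C(K, ℝ)) (r : ℝ), 0 ≤ r →
      MeasurableSet (F ⁻¹' Metric.closedBall f r) := by
    intro f r hr
    -- By continuity the sup-norm condition need only be checked on the countable dense set `D`.
    have : F ⁻¹' Metric.closedBall f r = ⋂ k ∈ D, {t | dist (F t k) (f k) ≤ r} := by
      ext t
      simp only [mem_preimage, Metric.mem_closedBall, mem_iInter, Set.mem_ofPred_eq]
      rw [ContinuousMap.dist_le hr]
      refine ⟨fun h k _ => h k, fun h k => ?_⟩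
      have hcl : IsClosed {k | dist (F t k) (f k) ≤ r} :=
        isClosed_le (by fun_prop) continuous_const
      have := hcl.closure_subset_iff.2 (fun k hk => h k hk)
      exact this (hDd k)
    rw [this]
    refine MeasurableSet.biInter hDc fun k _ => ?_
    exact measurableSet_le ((hF k).dist measurable_const) measurable_const
  refine measurable_of_isOpen fun U hU => ?_
  obtain ⟨S, hSc, hSd⟩ := TopologicalSpace.exists_countable_dense C(K, ℝ)
  -- Separability of `C(K, ℝ)` makes every open set a countable union of closed balls.
  have hUeq : U = ⋃ f ∈ S, ⋃ n ∈ {n : ℕ | Metric.closedBall f ((n : ℝ) + 1)⁻¹ ⊆ U},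
      Metric.closedBall f ((n : ℝ) + 1)⁻¹ := by
    ext g
    simp only [mem_iUnion, Set.mem_ofPred_eq, exists_prop]
    constructor
    · intro hg
      obtain ⟨ε, hε, hεU⟩ := Metric.isOpen_iff.1 hU g hg
      obtain ⟨n, hn⟩ := exists_nat_one_div_lt (half_pos hε)
      rw [one_div] at hn
      have hpos : (0 : ℝ) < ((n : ℝ) + 1)⁻¹ := by positivity
      obtain ⟨f, hfS, hf⟩ := hSd.exists_dist_lt g hpos
      refine ⟨f, hfS, n, fun h hh => hεU ?_, ?_⟩
      · rw [Metric.mem_closedBall] at hh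
        rw [Metric.mem_ball]
        have := dist_triangle h f g
        rw [dist_comm f g] at this
        linarith
      · exact Metric.mem_closedBall.2 hf.le
    · rintro ⟨f, -, n, hn, hg⟩
      exact hn hg
  rw [hUeq]
  simp only [preimage_iUnion]
  refine MeasurableSet.biUnion hSc fun f _ => ?_
  refine MeasurableSet.biUnion (to_countable _) fun n _ => ?_
  exact hball f _ (by positivity)

/-- **Uniform strong law of large numbers** over a compact parameter space. -/
theorem uniform_strong_law {K T Ω : Type*} [MetricSpace K] [CompactSpace K] [MeasurableSpace T]
    [MeasurableSpace Ω] {P : Measure Ω} [IsProbabilityMeasure P] {ν : Measure T}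
    {F : T → C(K, ℝ)} {C : ℝ} (hF : ∀ k, Measurable fun t => F t k) (hC : ∀ t, ‖F t‖ ≤ C)
    {X : ℕ → Ω → T} (hindep : iIndepFun X P) (hlaw : ∀ i, HasLaw (X i) ν P) :
    ∃ L : C(K, ℝ), (∀ k, L k = ∫ t, F t k ∂ν) ∧
      ∀ᵐ ω ∂P, Tendsto (fun n : ℕ => (n : ℝ)⁻¹ • ∑ i ∈ Finset.range n, F (X i ω)) atTop (𝓝 L) := by
  borelize C(K, ℝ)
  have hFm : Measurable F := ContinuousMap.measurable_of_measurable_eval hF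
  have hν : IsProbabilityMeasure ν := (hlaw 0).isProbabilityMeasure_iff.1 inferInstance
  have hXm := fun i => (hlaw i).aemeasurable
  have hint : Integrable F ν :=
    Integrable.of_bound hFm.aestronglyMeasurable C (ae_of_all _ hC)
  have hint0 : Integrable (fun ω => F (X 0 ω)) P :=
    Integrable.of_bound (hFm.comp_aemeasurable (hXm 0)).aestronglyMeasurable C
      (ae_of_all _ fun ω => hC _)
  refine ⟨∫ t, F t ∂ν, fun k => ?_, ?_⟩
  · exact ((ContinuousMap.evalCLM ℝ k).integral_comp_comm hint).symm
  · have h := strong_law_ae (μ := P) (fun i ω => F (X i ω)) hint0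
      (fun i j hij => (hindep.indepFun hij).comp hFm hFm)
      (fun i => (IdentDistrib.comp
        ⟨hXm i, hXm 0, by rw [(hlaw i).map_eq, (hlaw 0).map_eq]⟩ hFm))
    have he : ∫ ω, F (X 0 ω) ∂P = ∫ t, F t ∂ν := by
      rw [← (hlaw 0).map_eq, integral_map (hXm 0) hFm.aestronglyMeasurable]
    rwa [he] at h

/-- **Wald's consistency theorem** over a compact parameter space: maximizers of the empirical
criterion converge almost surely to the unique maximizer of its expectation. -/
theorem ae_tendsto_maximizer {K T Ω : Type*} [MetricSpace K] [CompactSpace K] [MeasurableSpace T]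
    [MeasurableSpace Ω] {P : Measure Ω} [IsProbabilityMeasure P] {ν : Measure T}
    {F : T → C(K, ℝ)} {C : ℝ} (hF : ∀ k, Measurable fun t => F t k) (hC : ∀ t, ‖F t‖ ≤ C)
    {X : ℕ → Ω → T} (hindep : iIndepFun X P) (hlaw : ∀ i, HasLaw (X i) ν P) (k₀ : K)
    (hmax : ∀ k, k ≠ k₀ → ∫ t, F t k ∂ν < ∫ t, F t k₀ ∂ν) :
    ∀ᵐ ω ∂P, ∀ e : ℕ → K,
      (∀ (n : ℕ) (k : K), (n : ℝ)⁻¹ * ∑ i ∈ Finset.range n, F (X i ω) k ≤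
        (n : ℝ)⁻¹ * ∑ i ∈ Finset.range n, F (X i ω) (e n)) →
      Tendsto e atTop (𝓝 k₀) := by
  obtain ⟨L, hL, hconv⟩ := uniform_strong_law hF hC hindep hlaw
  filter_upwards [hconv] with ω hω e he
  set ℓ : ℕ → C(K, ℝ) := fun n => (n : ℝ)⁻¹ • ∑ i ∈ Finset.range n, F (X i ω) with hℓ
  have hℓv : ∀ n k, ℓ n k = (n : ℝ)⁻¹ * ∑ i ∈ Finset.range n, F (X i ω) k := by
    intro n k
    simp [hℓ]
  have hLe : Tendsto (fun n => L (e n)) atTop (𝓝 (L k₀)) := by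
    -- The factor 2 pays for replacing `ℓ n` by `L` twice, at `k₀` and at `e n`.
    have hd : Tendsto (fun n => L k₀ - 2 * dist (ℓ n) L) atTop (𝓝 (L k₀)) := by
      have := (tendsto_iff_dist_tendsto_zero.1 hω).const_mul 2
      simpa using tendsto_const_nhds.sub this
    refine tendsto_of_tendsto_of_tendsto_of_le_of_le hd tendsto_const_nhds (fun n => ?_) fun n => ?_
    · have h1 := abs_le.1 (ContinuousMap.dist_apply_le_dist (f := ℓ n) (g := L) k₀)
      have h2 := abs_le.1 (ContinuousMap.dist_apply_le_dist (f := ℓ n) (g := L) (e n))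
      have h3 := he n k₀
      rw [← hℓv, ← hℓv] at h3
      simp only
      linarith [h1.1, h2.2]
    · by_cases h : e n = k₀
      · simp [h]
      · rw [hL, hL]
        exact (hmax _ h).le
  rw [tendsto_iff_forall_eventually_mem]
  intro s hs
  obtain ⟨U, hUs, hUo, hkU⟩ := mem_nhds_iff.1 hs
  rcases (Uᶜ).eq_empty_or_nonempty with hUe | hUne
  · have : U = univ := compl_empty_iff.1 hUe
    exact Eventually.of_forall fun n => hUs (by rw [this]; trivial)
  · obtain ⟨k₁, hk₁, hk₁m⟩ := hUo.isClosed_compl.isCompact.exists_isMaxOn hUne L.continuous.continuousOn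
    have hlt : L k₁ < L k₀ := by
      rw [hL, hL]
      exact hmax _ fun h => hk₁ (h ▸ hkU)
    filter_upwards [hLe.eventually_const_lt hlt] with n hn
    by_contra hns
    exact absurd (hk₁m (show e n ∈ Uᶜ from fun h => hns (hUs h))) (not_le.2 hn)

/-! ### Central limit theorem and linearized estimating equations. -/

/-- **Multivariate central limit theorem** for centred square-integrable vectors. -/
theorem tendstoInDistribution_multivariateGaussian {ι Ω : Type*} [Fintype ι] [DecidableEq ι]
    [MeasurableSpace Ω] {P : Measure Ω} [IsProbabilityMeasure P]
    {Y : ℕ → Ω → EuclideanSpace ℝ ι} {S : Matrix ι ι ℝ} (hS : S.PosSemidef)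
    (hindep : iIndepFun Y P) (hident : ∀ i, IdentDistrib (Y i) (Y 0) P P) (hL2 : MemLp (Y 0) 2 P)
    (hmean : ∀ t, ∫ ω, inner ℝ (Y 0 ω) t ∂P = 0)
    (hvar : ∀ t : EuclideanSpace ℝ ι, ∫ ω, (inner ℝ (Y 0 ω) t) ^ 2 ∂P = t ⬝ᵥ S.mulVec t) :
    TendstoInDistribution (fun (n : ℕ) ω => (√(n : ℝ))⁻¹ • ∑ k ∈ Finset.range n, Y k ω) atTop id
      (fun _ => P) (multivariateGaussian 0 S) where
  forall_aemeasurable n :=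
    (Finset.aemeasurable_fun_sum (f := Y) _ fun i _ =>
      (hident i).aemeasurable_fst).const_smul ((√(n : ℝ))⁻¹)
  tendsto := by
    -- Cramér–Wold: the characteristic function at `t` is that of the scalar projection onto `t` at
    -- `1`, to which the one-dimensional theorem applies.
    refine ProbabilityMeasure.tendsto_iff_tendsto_charFun.2 fun t => ?_
    have hY0 : AEMeasurable (Y 0) P := (hident 0).aemeasurable_snd
    have hm : Measurable fun y : EuclideanSpace ℝ ι => inner ℝ y t := by fun_prop
    have hL2' : MemLp (fun ω => inner ℝ (Y 0 ω) t) 2 P := hL2.inner_const t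
    have hvar0 : Var[fun ω => inner ℝ (Y 0 ω) t; P] = t ⬝ᵥ S.mulVec t := by
      rw [variance_of_integral_eq_zero hL2'.aemeasurable (hmean t), ← hvar t]
    have hclt := (tendstoInDistribution_inv_sqrt_mul_sum_sub (P := P)
      (X := fun i ω => inner ℝ (Y i ω) t) (Y := id)
      (P' := gaussianReal 0 (Var[fun ω => inner ℝ (Y 0 ω) t; P]).toNNReal) HasLaw.id hL2'
      (hindep.comp (fun _ y => inner ℝ y t) fun _ => hm)
      (fun i => (hident i).comp hm)).tendsto
    have h1 := ProbabilityMeasure.tendsto_iff_tendsto_charFun.1 hclt 1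
    have hb : charFun (multivariateGaussian 0 S) t =
        charFun (gaussianReal 0 (Var[fun ω => inner ℝ (Y 0 ω) t; P]).toNNReal) 1 := by
      rw [charFun_multivariateGaussian hS, charFun_gaussianReal, hvar0]
      have h0 : 0 ≤ t ⬝ᵥ S.mulVec t := by rw [← hvar]; positivity
      simp [Real.coe_toNNReal _ h0]
    simp only [ProbabilityMeasure.coe_mk, Measure.map_id] at h1 ⊢
    rw [hb]
    refine h1.congr fun n => ?_
    have hs : AEMeasurable (fun ω => ∑ k ∈ Finset.range n, Y k ω) P :=
      Finset.aemeasurable_fun_sum _ fun i _ => (hident i).aemeasurable_fst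
    have hs2 : AEMeasurable (fun ω => ∑ k ∈ Finset.range n, inner ℝ (Y k ω) t) P :=
      Finset.aemeasurable_fun_sum _ fun i _ => hm.comp_aemeasurable (hident i).aemeasurable_fst
    rw [charFun_apply, charFun_apply, integral_map (by fun_prop) (by fun_prop),
      integral_map (by fun_prop) (by fun_prop)]
    refine integral_congr_ae (ae_of_all _ fun ω => ?_)
    simp [inner_smul_left, sum_inner, hmean t]

/-- Asymptotic normality from a linearized estimating equation: if `∑ Yᵢ + (∑ Bᵢ) Δₙ` is
`O(n ‖Δₙ‖²)`, the average of the `Bᵢ` tends to `-1`, and `Δₙ → 0`, then `√n Δₙ` has the same limit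
in distribution as `n^{-1/2} ∑ Yᵢ`. -/
theorem tendstoInDistribution_of_linearized {E Ω Ω' : Type*} [NormedAddCommGroup E]
    [NormedSpace ℝ E] [SecondCountableTopology E]
    [MeasurableSpace E] [BorelSpace E] [MeasurableSpace Ω] [MeasurableSpace Ω'] {P : Measure Ω}
    [IsProbabilityMeasure P] {P' : Measure Ω'} [IsProbabilityMeasure P'] {Z : Ω' → E}
    {Y : ℕ → Ω → E} {B : ℕ → Ω → E →L[ℝ] E} {Δ : ℕ → Ω → E} {C : ℝ}
    (hY : TendstoInDistribution (fun (n : ℕ) ω => (√(n : ℝ))⁻¹ • ∑ k ∈ Finset.range n, Y k ω)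
      atTop Z (fun _ => P) P')
    (hB : ∀ᵐ ω ∂P, Tendsto (fun n : ℕ => (n : ℝ)⁻¹ • ∑ i ∈ Finset.range n, B i ω) atTop (𝓝 (-1)))
    (hΔm : ∀ n, AEMeasurable (Δ n) P) (hΔ : ∀ᵐ ω ∂P, Tendsto (fun n => Δ n ω) atTop (𝓝 0))
    (hlin : ∀ᵐ ω ∂P, ∀ᶠ n : ℕ in atTop,
      ‖∑ i ∈ Finset.range n, Y i ω + (∑ i ∈ Finset.range n, B i ω) (Δ n ω)‖ ≤
        n * (C * ‖Δ n ω‖ ^ 2)) :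
    TendstoInDistribution (fun (n : ℕ) ω => √(n : ℝ) • Δ n ω) atTop Z (fun _ => P) P' := by
  set T : ℕ → Ω → E := fun n ω => (√(n : ℝ))⁻¹ • ∑ k ∈ Finset.range n, Y k ω with hT
  -- `T n` converges only in distribution and may be unbounded along a path. Dividing the error by
  -- `1 + ‖T n‖` makes it tend to `0` almost surely, and `√n Δₙ = T n + (1 + ‖T n‖) a n` is a
  -- continuous function of the pair, as Slutsky's theorem requires.
  set a : ℕ → Ω → E := fun n ω => (1 + ‖T n ω‖)⁻¹ • (√(n : ℝ) • Δ n ω - T n ω) with ha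
  have hTm : ∀ n, AEMeasurable (T n) P := hY.forall_aemeasurable
  have ham : ∀ n, AEMeasurable (a n) P := fun n =>
    (((hTm n).norm.const_add 1).inv).smul (((hΔm n).const_smul _).sub (hTm n))
  have ha0 : ∀ᵐ ω ∂P, Tendsto (fun n => a n ω) atTop (𝓝 0) := by
    filter_upwards [hB, hΔ, hlin] with ω hBω hΔω hlinω
    set ε : ℕ → ℝ := fun n =>
      ‖(n : ℝ)⁻¹ • ∑ i ∈ Finset.range n, B i ω + 1‖ + C * ‖Δ n ω‖ with hε
    have hε0 : Tendsto ε atTop (𝓝 0) := by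
      have h1 := (hBω.add_const (1 : E →L[ℝ] E)).norm
      have h2 := hΔω.norm.const_mul C
      simpa using h1.add h2
    -- From `‖W‖ ≤ ε ‖√n Δ‖` and `‖√n Δ‖ ≤ ‖W‖ + ‖T‖` with `ε < 1/2` one gets `‖√n Δ‖ ≤ 2 ‖T‖`,
    -- hence `‖W‖ ≤ 2 ε ‖T‖`.
    have hev : ∀ᶠ n in atTop, ‖a n ω‖ ≤ 2 * ε n := by
      filter_upwards [hlinω, hε0.eventually_lt_const (show (0 : ℝ) < 1 / 2 by norm_num),
        eventually_gt_atTop 0] with n hn hεn hnpos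
      have hn0 : (0 : ℝ) < n := by exact_mod_cast hnpos
      have hsq : (0 : ℝ) < √(n : ℝ) := Real.sqrt_pos.2 hn0
      have hsqsq : √(n : ℝ) * √(n : ℝ) = n := Real.mul_self_sqrt hn0.le
      set W := √(n : ℝ) • Δ n ω - T n ω with hW
      have hid : W = √(n : ℝ) • (((n : ℝ)⁻¹ • ∑ i ∈ Finset.range n, B i ω + 1) (Δ n ω)) -
          (√(n : ℝ))⁻¹ • (∑ i ∈ Finset.range n, Y i ω +
            (∑ i ∈ Finset.range n, B i ω) (Δ n ω)) := by
        have : √(n : ℝ) * (n : ℝ)⁻¹ = (√(n : ℝ))⁻¹ := by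
          field_simp
          rw [sq, hsqsq]
        simp only [hW, hT, add_apply, smul_apply,
          one_apply_eq_self, smul_add, smul_smul, this]
        abel
      have hWle : ‖W‖ ≤ ε n * ‖√(n : ℝ) • Δ n ω‖ := by
        have h1 : ‖√(n : ℝ) • (((n : ℝ)⁻¹ • ∑ i ∈ Finset.range n, B i ω + 1) (Δ n ω))‖ ≤
            √(n : ℝ) * (‖(n : ℝ)⁻¹ • ∑ i ∈ Finset.range n, B i ω + 1‖ * ‖Δ n ω‖) := by
          rw [norm_smul, Real.norm_of_nonneg hsq.le]
          gcongr
          exact ContinuousLinearMap.le_opNorm _ _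
        have h2 : ‖(√(n : ℝ))⁻¹ • (∑ i ∈ Finset.range n, Y i ω +
            (∑ i ∈ Finset.range n, B i ω) (Δ n ω))‖ ≤ √(n : ℝ) * (C * ‖Δ n ω‖ ^ 2) := by
          rw [norm_smul, norm_inv, Real.norm_of_nonneg hsq.le]
          calc _ ≤ (√(n : ℝ))⁻¹ * (n * (C * ‖Δ n ω‖ ^ 2)) := by gcongr
            _ = _ := by
              field_simp
              rw [sq (√(n : ℝ)), hsqsq]
        rw [hid, norm_smul (√(n : ℝ)) (Δ n ω), Real.norm_of_nonneg hsq.le]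
        refine (norm_sub_le _ _).trans ((add_le_add h1 h2).trans (le_of_eq ?_))
        simp only [hε]
        ring
      have hΔle : ‖√(n : ℝ) • Δ n ω‖ ≤ ‖W‖ + ‖T n ω‖ := by
        have := norm_add_le W (T n ω)
        simpa [hW] using this
      have hε_nonneg : 0 ≤ ε n * ‖√(n : ℝ) • Δ n ω‖ := (norm_nonneg _).trans hWle
      have hpos : 0 < 1 + ‖T n ω‖ := by positivity
      simp only [ha]
      rw [norm_smul, norm_inv, Real.norm_of_nonneg hpos.le, inv_mul_le_iff₀ hpos]
      change ‖W‖ ≤ _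
      -- The sign of `C` is not known. A negative `ε n` would force `Δ n ω = 0`, and then `ε n` is a
      -- norm, a contradiction.
      rcases le_or_gt 0 (ε n) with h0 | h0
      · have h3 : ‖√(n : ℝ) • Δ n ω‖ ≤ 2 * ‖T n ω‖ := by
          have : ε n * ‖√(n : ℝ) • Δ n ω‖ ≤ 1 / 2 * ‖√(n : ℝ) • Δ n ω‖ := by gcongr
          linarith
        calc ‖W‖ ≤ ε n * (2 * ‖T n ω‖) := hWle.trans (by gcongr)
          _ ≤ (1 + ‖T n ω‖) * (2 * ε n) := by nlinarith
      · have hz : ‖√(n : ℝ) • Δ n ω‖ = 0 := by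
          by_contra hne
          have : 0 < ‖√(n : ℝ) • Δ n ω‖ := lt_of_le_of_ne (norm_nonneg _) (Ne.symm hne)
          nlinarith
        have hΔ0 : Δ n ω = 0 := by
          have := norm_eq_zero.1 hz
          exact (smul_eq_zero.1 this).resolve_left hsq.ne'
        exfalso
        simp only [hε, hΔ0, norm_zero, mul_zero, add_zero] at h0
        exact absurd (norm_nonneg _) (not_le.2 h0)
    exact squeeze_zero_norm' hev (by simpa using hε0.const_mul 2)
  have hslutsky := TendstoInDistribution.continuous_comp_prodMk_of_tendstoInMeasure_const
    (g := fun p : E × E => p.1 + (1 + ‖p.1‖) • p.2) (by fun_prop) hY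
    (tendstoInMeasure_of_tendsto_ae (fun n => (ham n).aestronglyMeasurable) ha0) ham
  refine hslutsky.congr (fun n => ae_of_all _ fun ω => ?_) (ae_of_all _ fun ω => by simp)
  have hpos : (1 + ‖T n ω‖) ≠ 0 := by positivity
  change T n ω + (1 + ‖T n ω‖) • a n ω = _
  simp only [ha, smul_smul, mul_inv_cancel₀ hpos, one_smul]
  abel

/-! ### The extended sine-skewed family: bounds, total mass, Gibbs' inequality, consistency. -/

namespace ESS

theorem continuous_g {m : ℝ} (hm : 0 ≤ m) : Continuous (g m) := by
  unfold g
  exact continuous_const.mul (Continuous.rpow_const (by fun_prop) fun x => Or.inr hm)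

theorem g_neg (m x : ℝ) : g m (-x) = g m x := by simp [g]

theorem g_pos {m x : ℝ} (hm : 0 ≤ m) (hx : x ∈ Ioo (-1 : ℝ) 1) : 0 < g m x := by
  have h1 : 0 < Real.Gamma (2 * (m + 1)) := Real.Gamma_pos_of_pos (by positivity)
  have h2 : 0 < Real.Gamma (m + 1) := Real.Gamma_pos_of_pos (by positivity)
  have h3 : 0 < 1 - x ^ 2 := by nlinarith [hx.1, hx.2]
  unfold g
  have := Real.rpow_pos_of_pos h3 m
  positivity

theorem hasDerivAt_G {m : ℝ} (hm : 0 ≤ m) (x : ℝ) : HasDerivAt (G m) (g m x) x :=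
  (continuous_g hm).integral_hasStrictDerivAt (-1) x |>.hasDerivAt

theorem continuous_G {m : ℝ} (hm : 0 ≤ m) : Continuous (G m) :=
  continuous_iff_continuousAt.2 fun x => (hasDerivAt_G hm x).continuousAt

/-- Evenness of `g` turns the mass below `-x` into the mass above `x`. This is what makes skewing
preserve the total mass. -/
theorem G_add_G_neg {m : ℝ} (hm : 0 ≤ m) (x : ℝ) : G m x + G m (-x) = G m 1 := by
  have h1 : G m (-x) = ∫ t in x..1, g m t := by
    have := intervalIntegral.integral_comp_neg (a := x) (b := 1) (fun t => g m t)
    simp only [g_neg] at this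
    rw [G, this]
  rw [h1, G, G]
  exact intervalIntegral.integral_add_adjacent_intervals
    ((continuous_g hm).intervalIntegrable _ _) ((continuous_g hm).intervalIntegrable _ _)

theorem G_strictMonoOn {m : ℝ} (hm : 0 ≤ m) : StrictMonoOn (G m) (Icc (-1) 1) := by
  refine strictMonoOn_of_deriv_pos (convex_Icc _ _) (continuous_G hm).continuousOn fun x hx => ?_
  rw [interior_Icc] at hx
  rw [(hasDerivAt_G hm x).deriv]
  exact g_pos hm hx

theorem G_pos {m x : ℝ} (hm : 0 ≤ m) (hx : x ∈ Ioc (-1 : ℝ) 1) : 0 < G m x := by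
  have h : G m (-1) = 0 := by simp [G]
  rw [← h]
  exact G_strictMonoOn hm (by simp) ⟨hx.1.le, hx.2⟩ hx.1

/-- Smoothness may fail at `±1`, where the base of the real power vanishes; hence the open interval.
-/
theorem contDiffOn_g (m : ℝ) {n : WithTop ℕ∞} : ContDiffOn ℝ n (g m) (Ioo (-1) 1) := by
  unfold g
  refine contDiffOn_const.mul (ContDiffOn.rpow_const_of_ne (by fun_prop) fun x hx => ?_)
  nlinarith [hx.1, hx.2]

theorem contDiffOn_G {m : ℝ} (hm : 0 ≤ m) (n : ℕ) : ContDiffOn ℝ n (G m) (Ioo (-1) 1) := by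
  have h : ContDiffOn ℝ ((n : WithTop ℕ∞) + 1) (G m) (Ioo (-1) 1) := by
    rw [contDiffOn_succ_iff_deriv_of_isOpen isOpen_Ioo]
    refine ⟨fun x _ => (hasDerivAt_G hm x).differentiableAt.differentiableWithinAt, by simp, ?_⟩
    exact (contDiffOn_g m).congr fun x _ => (hasDerivAt_G hm x).deriv
  exact h.of_le le_self_add

/-- This is the role of `δ`: the argument of `G` stays in a fixed compact part of `(-1, 1)`, where
`G` is smooth and positive. -/
theorem mul_sin_mem_Icc {δ l : ℝ} (hl : l ∈ Icc (-1 + δ) (1 - δ)) (x : ℝ) :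
    l * Real.sin x ∈ Icc (-1 + δ) (1 - δ) := by
  have h1 : |l| ≤ 1 - δ := abs_le.2 ⟨by linarith [hl.1], hl.2⟩
  have h2 : |l * Real.sin x| ≤ 1 - δ := by
    rw [abs_mul]
    calc _ ≤ |l| * 1 := by gcongr; exact Real.abs_sin_le_one x
      _ ≤ _ := by linarith
  have := abs_le.1 h2
  exact ⟨by linarith [this.1], this.2⟩

theorem Icc_subset_Ioo_of_pos {δ : ℝ} (hδ : 0 < δ) :
    Icc (-1 + δ) (1 - δ) ⊆ Ioo (-1 : ℝ) 1 := fun _ hx => ⟨by linarith [hx.1], by linarith [hx.2]⟩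

variable {d : ℕ} {m : ℝ} {f₀ : ℝ → Shape d → ℝ} {M : Set ℝ} {R : Set (Shape d)} {δ : ℝ}

/-- The bounds on the base densities hold on the whole line, by periodicity. -/
theorem CondA4.exists_bounds (hA4 : CondA4 f₀ R)
    (hf₀ : ∀ ρ ∈ R, IsCircularDensity fun θ => f₀ θ ρ) :
    ∃ q > 0, ∃ Q, ∀ θ, ∀ ρ ∈ R, f₀ θ ρ ∈ Icc q Q := by
  obtain ⟨Q, -, q, hq, h⟩ := hA4
  refine ⟨q, hq, Q, fun θ ρ hρ => ?_⟩
  obtain ⟨y, hy, hyθ⟩ := (hf₀ ρ hρ).periodic.exists_mem_Ico Real.two_pi_pos θ (-Real.pi)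
  have := h y ⟨hy.1, by linarith [hy.2]⟩ ρ hρ
  rw [hyθ]
  exact ⟨this.1.le, this.2.le⟩

theorem density_periodic (hf₀ : ∀ ρ ∈ R, IsCircularDensity fun θ => f₀ θ ρ) {η : Param d}
    (hη : shape η ∈ R) : Function.Periodic (density m f₀ η) (2 * Real.pi) := by
  intro θ
  have h := (hf₀ _ hη).periodic (θ - loc η)
  simp only [density]
  rw [show θ + 2 * Real.pi - loc η = θ - loc η + 2 * Real.pi by ring, h, Real.sin_add_two_pi]

theorem continuous_density (hm : 0 ≤ m) (hA1 : CondA1 f₀ R) {η : Param d} (hη : shape η ∈ R) :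
    Continuous (density m f₀ η) := by
  have h1 : Continuous fun θ => f₀ (θ - loc η) (shape η) :=
    (hA1 _ hη).1.comp (continuous_id.sub continuous_const)
  have h2 := (continuous_G hm).comp
    (show Continuous fun θ => skew η * Real.sin (θ - loc η) by fun_prop)
  exact (continuous_const.mul h1).mul h2

/-- The densities of the model are bounded, and bounded away from zero, uniformly. -/
theorem exists_density_bounds (hm : 0 ≤ m) (hδ : 0 < δ)
    (hf₀ : ∀ ρ ∈ R, IsCircularDensity fun θ => f₀ θ ρ) (hA4 : CondA4 f₀ R) :
    ∃ a > 0, ∃ b, ∀ η ∈ paramSpace M R δ, ∀ θ, density m f₀ η θ ∈ Icc a b := by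
  obtain ⟨q, hq, Q, h⟩ := hA4.exists_bounds hf₀
  -- For `δ > 1` the parameter space is empty and any constants serve.
  rcases lt_or_ge 1 δ with hδ1 | hδ1
  · refine ⟨1, one_pos, 1, fun η hη => ?_⟩
    have := hη.2.2
    exact absurd (this.1.trans this.2) (by linarith)
  have hmono := (G_strictMonoOn hm).monotoneOn
  have hc : 0 < G m (-1 + δ) := G_pos hm ⟨by linarith, by linarith⟩
  refine ⟨2 * q * G m (-1 + δ), by positivity, 2 * Q * G m 1, fun η hη θ => ?_⟩
  have hv := mul_sin_mem_Icc hη.2.2 (θ - loc η)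
  have hv1 := Icc_subset_Ioo_of_pos hδ hv
  have h1 := h (θ - loc η) _ hη.2.1
  have h2 : G m (-1 + δ) ≤ G m (skew η * Real.sin (θ - loc η)) :=
    hmono ⟨by linarith, by linarith⟩ ⟨hv1.1.le, hv1.2.le⟩ hv.1
  have h3 : G m (skew η * Real.sin (θ - loc η)) ≤ G m 1 :=
    hmono ⟨hv1.1.le, hv1.2.le⟩ (by simp) hv1.2.le
  have h4 : 0 ≤ f₀ (θ - loc η) (shape η) := hq.le.trans h1.1
  simp only [density]
  constructor
  · gcongr
    exact h1.1
  · have := hc.trans_le h2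
    exact mul_le_mul (by linarith [h1.2]) h3 this.le (by linarith [h1.2])

/-- Total mass of a member of the family. -/
theorem integral_density (hm : 0 ≤ m) (hf₀ : ∀ ρ ∈ R, IsCircularDensity fun θ => f₀ θ ρ)
    (hA1 : CondA1 f₀ R) {η : Param d} (hη : shape η ∈ R) :
    ∫ θ in (-Real.pi)..Real.pi, density m f₀ η θ = G m 1 := by
  have hper := density_periodic (m := m) hf₀ hη
  set φ : ℝ → ℝ := fun θ => 2 * f₀ θ (shape η) * G m (skew η * Real.sin θ) with hφ
  have hφc : Continuous φ := (continuous_const.mul (hA1 _ hη).1).mul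
    ((continuous_G hm).comp (show Continuous fun θ => skew η * Real.sin θ by fun_prop))
  have hφper : Function.Periodic φ (2 * Real.pi) := by
    intro θ
    have h := (hf₀ _ hη).periodic θ
    simp only [hφ, h, Real.sin_add_two_pi]
  -- Periodicity removes the shift by `μ`.
  have h1 : ∫ θ in (-Real.pi)..Real.pi, density m f₀ η θ = ∫ θ in (-Real.pi)..Real.pi, φ θ := by
    have := intervalIntegral.integral_comp_sub_right (a := -Real.pi) (b := Real.pi) φ (loc η)
    have h2 := hφper.intervalIntegral_add_eq (-Real.pi - loc η) (-Real.pi)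
    rw [show -Real.pi - loc η + 2 * Real.pi = Real.pi - loc η by ring,
      show -Real.pi + 2 * Real.pi = Real.pi by ring] at h2
    rw [← h2, ← this]
    rfl
  have h2 : ∫ θ in (-Real.pi)..Real.pi, φ (-θ) = ∫ θ in (-Real.pi)..Real.pi, φ θ := by
    rw [intervalIntegral.integral_comp_neg, neg_neg]
  -- The base density is even and the sine odd, so pairing `θ` with `-θ` replaces the skewing factor
  -- by the constant `G m 1`.
  have h3 : ∀ θ, φ θ + φ (-θ) = 2 * G m 1 * f₀ θ (shape η) := by
    intro θ
    simp only [hφ, Real.sin_neg, (hA1 _ hη).2.2 θ, mul_neg]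
    rw [← G_add_G_neg hm (skew η * Real.sin θ)]
    ring
  have h4 : ∫ θ in (-Real.pi)..Real.pi, (φ θ + φ (-θ)) = 2 * G m 1 := by
    simp_rw [h3]
    rw [intervalIntegral.integral_const_mul, (hf₀ _ hη).integral_eq_one, mul_one]
  rw [intervalIntegral.integral_add (g := fun θ => φ (-θ)) (hφc.intervalIntegrable _ _)
    ((hφc.comp continuous_neg).intervalIntegrable _ _), h2] at h4
  rw [h1]
  linarith

/-- No measurability or integrability of `h` is needed, because the density itself is measurable and
finite. -/
theorem integral_law {η : Param d} (hm : 0 ≤ m) (hA1 : CondA1 f₀ R) (hη : shape η ∈ R)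
    (hpos : ∀ θ, 0 ≤ density m f₀ η θ) (h : ℝ → ℝ) :
    ∫ θ, h θ ∂(law m f₀ η) = ∫ θ in Ico (-Real.pi) Real.pi, density m f₀ η θ * h θ := by
  rw [law, integral_withDensity_eq_integral_toReal_smul
    (continuous_density hm hA1 hη).measurable.ennreal_ofReal (ae_of_all _ fun θ => by simp)]
  simp [ENNReal.toReal_ofReal (hpos _)]

theorem integral_law_eq_intervalIntegral {η : Param d} (hm : 0 ≤ m) (hA1 : CondA1 f₀ R)
    (hη : shape η ∈ R) (hpos : ∀ θ, 0 ≤ density m f₀ η θ) (h : ℝ → ℝ) :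
    ∫ θ, h θ ∂(law m f₀ η) = ∫ θ in (-Real.pi)..Real.pi, density m f₀ η θ * h θ := by
  rw [integral_law hm hA1 hη hpos, integral_Ico_eq_integral_Ioc,
    ← intervalIntegral.integral_of_le (by linarith [Real.pi_pos])]

/-- If one member of the family is a probability law then the distribution function `G m` is
normalized. -/
theorem G_one_of_isProbabilityMeasure {η : Param d} (hm : 0 ≤ m)
    (hf₀ : ∀ ρ ∈ R, IsCircularDensity fun θ => f₀ θ ρ) (hA1 : CondA1 f₀ R) (hη : shape η ∈ R)
    (hpos : ∀ θ, 0 ≤ density m f₀ η θ) (hp : IsProbabilityMeasure (law m f₀ η)) : G m 1 = 1 := by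
  have := integral_law_eq_intervalIntegral hm hA1 hη hpos (fun _ => 1)
  simp only [mul_one, integral_density hm hf₀ hA1 hη] at this
  rw [← this]
  simp

/-- Gibbs' inequality for positive continuous periodic densities. -/
theorem intervalIntegral_mul_log_lt {p p₀ : ℝ → ℝ} (hp : Continuous p) (hp₀ : Continuous p₀)
    (hpos : ∀ θ, 0 < p θ) (hpos₀ : ∀ θ, 0 < p₀ θ) (hper : Function.Periodic p (2 * Real.pi))
    (hper₀ : Function.Periodic p₀ (2 * Real.pi))
    (hint : ∫ θ in (-Real.pi)..Real.pi, p θ = ∫ θ in (-Real.pi)..Real.pi, p₀ θ) (hne : p ≠ p₀) :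
    ∫ θ in (-Real.pi)..Real.pi, p₀ θ * Real.log (p θ) <
      ∫ θ in (-Real.pi)..Real.pi, p₀ θ * Real.log (p₀ θ) := by
  have hlog : ∀ f : ℝ → ℝ, Continuous f → (∀ θ, 0 < f θ) → Continuous fun θ => Real.log (f θ) :=
    fun f hf h => hf.log fun θ => (h θ).ne'
  have hc1 : Continuous fun θ => p₀ θ * Real.log (p θ) := hp₀.mul (hlog p hp hpos)
  have hc2 : Continuous fun θ => p₀ θ * Real.log (p₀ θ) := hp₀.mul (hlog p₀ hp₀ hpos₀)
  have hc3 : Continuous fun θ => p θ - p₀ θ := hp.sub hp₀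
  have key : ∀ θ, p₀ θ * Real.log (p θ) = p₀ θ * Real.log (p₀ θ) +
      p₀ θ * Real.log (p θ / p₀ θ) := by
    intro θ
    rw [Real.log_div (hpos θ).ne' (hpos₀ θ).ne']
    ring
  have key2 : ∀ θ, p₀ θ * (p θ / p₀ θ - 1) = p θ - p₀ θ := by
    intro θ
    have := (hpos₀ θ).ne'
    field_simp
  -- This is `log x ≤ x - 1` at `x = p / p₀`; the added term `p - p₀` integrates to zero. Continuity
  -- gives strictness from a single point where `p ≠ p₀`, moved into the base period.
  have hlt : ∫ θ in (-Real.pi)..Real.pi, p₀ θ * Real.log (p θ) <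
      ∫ θ in (-Real.pi)..Real.pi, (p₀ θ * Real.log (p₀ θ) + (p θ - p₀ θ)) := by
    refine intervalIntegral.integral_lt_integral_of_continuousOn_of_le_of_exists_lt
      (by linarith [Real.pi_pos]) hc1.continuousOn (hc2.add hc3).continuousOn ?_ ?_
    · intro θ _
      rw [key, ← key2]
      have := Real.log_le_sub_one_of_pos (div_pos (hpos θ) (hpos₀ θ))
      have h0 := (hpos₀ θ).le
      gcongr
    · obtain ⟨θ, hθ⟩ := Function.ne_iff.1 hne
      obtain ⟨y, hy, hyθ⟩ := (hper.sub hper₀).exists_mem_Ico Real.two_pi_pos θ (-Real.pi)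
      refine ⟨y, ⟨hy.1, by linarith [hy.2]⟩, ?_⟩
      have hy' : p y ≠ p₀ y := fun h => hθ (by
        simp only [Pi.sub_apply, h, sub_self] at hyθ
        linarith)
      rw [key, ← key2]
      have h1 : p y / p₀ y ≠ 1 := fun h => hy' ((div_eq_one_iff_eq (hpos₀ y).ne').1 h)
      have := Real.log_lt_sub_one_of_pos (div_pos (hpos y) (hpos₀ y)) h1
      have h0 := hpos₀ y
      gcongr
  rw [intervalIntegral.integral_add (hc2.intervalIntegrable _ _)
    (hc3.intervalIntegrable _ _), intervalIntegral.integral_sub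
    (hp.intervalIntegrable _ _) (hp₀.intervalIntegrable _ _), hint, sub_self, add_zero] at hlt
  exact hlt

/-- The pair `(μ, ρ)` as a continuous linear function of `η`. -/
noncomputable def locShape (d : ℕ) : Param d →L[ℝ] ℝ × Shape d :=
  LinearMap.toContinuousLinearMap
    { toFun := fun η => (loc η, shape η)
      map_add' := fun x y => by
        refine Prod.ext (by simp [loc]) ?_
        ext i
        simp [shape]
      map_smul' := fun c x => by
        refine Prod.ext (by simp [loc]) ?_
        ext i
        simp [shape] }

@[simp]
theorem locShape_apply (η : Param d) : locShape d η = (loc η, shape η) := rfl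

theorem continuous_loc : Continuous (loc : Param d → ℝ) := by unfold loc; fun_prop

theorem continuous_skew : Continuous (skew : Param d → ℝ) := by unfold skew; fun_prop

theorem continuousOn_density (hm : 0 ≤ m)
    (hcont : ∀ θ : ℝ, ContinuousOn (fun p : ℝ × Shape d => f₀ (θ - p.1) p.2) (M ×ˢ R)) (θ : ℝ) :
    ContinuousOn (fun η => density m f₀ η θ) (paramSpace M R δ) := by
  have h1 : ContinuousOn (fun η : Param d => f₀ (θ - loc η) (shape η)) (paramSpace M R δ) :=
    (hcont θ).comp (locShape d).continuous.continuousOn fun η hη => ⟨hη.1, hη.2.1⟩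
  have h2 : Continuous fun η : Param d => G m (skew η * Real.sin (θ - loc η)) :=
    (continuous_G hm).comp (continuous_skew.mul
      (Real.continuous_sin.comp (continuous_const.sub continuous_loc)))
  exact (continuousOn_const.mul h1).mul h2.continuousOn

/-- On the parameter space the log-likelihood is the average of the log-densities. -/
theorem logLik_eq (hm : 0 ≤ m) (hδ : 0 < δ)
    (hf₀ : ∀ ρ ∈ R, IsCircularDensity fun θ => f₀ θ ρ) (hA4 : CondA4 f₀ R) (x : ℕ → ℝ) (n : ℕ)
    {η : Param d} (hη : η ∈ paramSpace M R δ) :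
    logLik m f₀ x n η = (n : ℝ)⁻¹ * ∑ i ∈ Finset.range n, Real.log (density m f₀ η (x i)) := by
  obtain ⟨q, hq, Q, h⟩ := hA4.exists_bounds hf₀
  rw [logLik, one_div]
  congr 1
  refine Finset.sum_congr rfl fun i _ => ?_
  have hv := Icc_subset_Ioo_of_pos hδ (mul_sin_mem_Icc hη.2.2 (x i - loc η))
  have h1 : 0 < f₀ (x i - loc η) (shape η) := hq.trans_le (h _ _ hη.2.1).1
  have h2 := G_pos hm ⟨hv.1, hv.2.le⟩
  rw [← Real.log_mul h1.ne' (by positivity), density]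
  congr 1
  ring

/-- Strong consistency of maximum likelihood estimators. -/
theorem ae_tendsto_mle (hm : 0 ≤ m) (hδ : 0 < δ)
    (hf₀ : ∀ ρ ∈ R, IsCircularDensity fun θ => f₀ θ ρ) (hA1 : CondA1 f₀ R) (hA4 : CondA4 f₀ R)
    (hA7 : CondA7 m f₀ (paramSpace M R δ)) {η₀ : Param d} {Ω : Type*} [MeasurableSpace Ω]
    {P : Measure Ω} [IsProbabilityMeasure P] {Θ : ℕ → Ω → ℝ} (hindep : iIndepFun Θ P)
    (hlaw : ∀ i, HasLaw (Θ i) (law m f₀ η₀) P) {ηhat : ℕ → Ω → Param d}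
    (hMLE : ∀ n, ∀ᵐ ω ∂P, IsMLE m f₀ (paramSpace M R δ) (fun i => Θ i ω) n (ηhat n ω))
    (hcomp : IsCompact (paramSpace M R δ)) (hη₀ : η₀ ∈ paramSpace M R δ)
    (hcont : ∀ θ : ℝ, ContinuousOn (fun p : ℝ × Shape d => f₀ (θ - p.1) p.2) (M ×ˢ R)) :
    ∀ᵐ ω ∂P, Tendsto (fun n => ηhat n ω) atTop (𝓝 η₀) := by
  obtain ⟨a, ha, b, hab⟩ := exists_density_bounds (m := m) (M := M) hm hδ hf₀ hA4
  have hpos : ∀ η ∈ paramSpace M R δ, ∀ θ, 0 < density m f₀ η θ :=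
    fun η hη θ => ha.trans_le (hab η hη θ).1
  have : CompactSpace (paramSpace M R δ) := isCompact_iff_compactSpace.1 hcomp
  -- The log-density of one observation, viewed as a random continuous function on the compact
  -- parameter space.
  let F : ℝ → C(paramSpace M R δ, ℝ) := fun θ =>
    ⟨fun η => Real.log (density m f₀ η θ), by
      have h := (continuousOn_density (δ := δ) hm hcont θ).log fun η hη => (hpos η hη θ).ne'
      exact continuousOn_iff_continuous_domRestrict.1 h⟩
  have hF : ∀ k, Measurable fun t => F t k := fun k =>
    ((continuous_density hm hA1 k.2.2.1).log fun θ => (hpos k k.2 θ).ne').measurable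
  have hC : ∀ t, ‖F t‖ ≤ max |Real.log a| |Real.log b| := by
    intro t
    rw [ContinuousMap.norm_le _ (le_max_of_le_left (abs_nonneg _))]
    intro η
    have h := hab η η.2 t
    exact abs_le_max_abs_abs (Real.log_le_log ha h.1) (Real.log_le_log (ha.trans_le h.1) h.2)
  have hmax : ∀ k : paramSpace M R δ, k ≠ ⟨η₀, hη₀⟩ →
      ∫ t, F t k ∂(law m f₀ η₀) < ∫ t, F t ⟨η₀, hη₀⟩ ∂(law m f₀ η₀) := by
    intro k hk
    have h0 := fun θ => (hpos η₀ hη₀ θ).le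
    rw [integral_law_eq_intervalIntegral hm hA1 hη₀.2.1 h0,
      integral_law_eq_intervalIntegral hm hA1 hη₀.2.1 h0]
    refine intervalIntegral_mul_log_lt (continuous_density hm hA1 k.2.2.1)
      (continuous_density hm hA1 hη₀.2.1) (hpos _ k.2) (hpos _ hη₀)
      (density_periodic hf₀ k.2.2.1) (density_periodic hf₀ hη₀.2.1) ?_
      (hA7 _ k.2 _ hη₀ fun h => hk (Subtype.ext h))
    rw [integral_density hm hf₀ hA1 k.2.2.1, integral_density hm hf₀ hA1 hη₀.2.1]
  have hcons := ae_tendsto_maximizer hF hC hindep hlaw ⟨η₀, hη₀⟩ hmax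
  filter_upwards [hcons, ae_all_iff.2 hMLE] with ω hω hM
  -- The exceptional null set does not depend on the sequence of maximizers, so the estimator can be
  -- substituted pathwise.
  have h := hω (fun n => ⟨ηhat n ω, (hM n).1⟩) fun n k => by
    have h1 := (hM n).2 k k.2
    rw [logLik_eq hm hδ hf₀ hA4 _ _ k.2, logLik_eq hm hδ hf₀ hA4 _ _ (hM n).1] at h1
    exact h1
  exact (continuous_subtype_val.tendsto _).comp h

end ESS

/-! ### Uniform derivative bounds for the log-density. -/

/-- The derivatives up to order `n` of a `C^n` function are bounded on compact sets. -/
theorem ContDiffOn.exists_norm_iteratedFDerivWithin_le {E F : Type*} [NormedAddCommGroup E]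
    [NormedSpace ℝ E] [NormedAddCommGroup F] [NormedSpace ℝ F] {f : E → F} {t K : Set E} {n : ℕ}
    (hf : ContDiffOn ℝ n f t) (ht : IsOpen t) (hK : IsCompact K) (hKt : K ⊆ t) :
    ∃ C, ∀ i ≤ n, ∀ x ∈ K, ‖iteratedFDerivWithin ℝ i f t x‖ ≤ C := by
  have h : ∀ i : ℕ, ∃ C, i ≤ n → ∀ x ∈ K, ‖iteratedFDerivWithin ℝ i f t x‖ ≤ C := by
    intro i
    by_cases hi : i ≤ n
    · obtain ⟨C, hC⟩ := hK.exists_bound_of_continuousOn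
        ((hf.continuousOn_iteratedFDerivWithin (by exact_mod_cast hi) ht.uniqueDiffOn).mono hKt)
      exact ⟨C, fun _ => hC⟩
    · exact ⟨0, fun h => absurd h hi⟩
  choose C hC using h
  refine ⟨∑ i ∈ Finset.range (n + 1), |C i|, fun i hi x hx => ?_⟩
  refine (hC i hi x hx).trans ((le_abs_self _).trans ?_)
  exact Finset.single_le_sum (f := fun i => |C i|) (fun _ _ => abs_nonneg _)
    (Finset.mem_range.2 (by omega))

namespace ESS

variable {d : ℕ} {m : ℝ} {f₀ : ℝ → Shape d → ℝ} {M : Set ℝ} {R : Set (Shape d)} {δ : ℝ}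

theorem locShape_surjective (d : ℕ) : Function.Surjective (locShape d) := by
  rintro ⟨μ, ρ⟩
  refine ⟨WithLp.toLp 2 (Fin.cons μ (Fin.snoc (α := fun _ => ℝ) ρ 0 : Fin (d + 1) → ℝ)), ?_⟩
  refine Prod.ext (by simp [loc]) ?_
  ext i
  simp [shape]

/-- A surjective linear map between these finite-dimensional spaces is open, so it carries the
interior of `H` into that of `M × R`. -/
theorem locShape_mem_interior {η : Param d} (hη : η ∈ interior (paramSpace M R δ)) :
    locShape d η ∈ interior (M ×ˢ R) := by
  have ho : IsOpenMap (locShape d) := (locShape d).isOpenMap (locShape_surjective d)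
  refine interior_maximal ?_ (ho _ isOpen_interior) (mem_image_of_mem _ hη)
  rintro _ ⟨η', hη', rfl⟩
  have := interior_subset hη'
  exact ⟨this.1, this.2.1⟩

theorem contDiff_loc {n : WithTop ℕ∞} : ContDiff ℝ n (loc : Param d → ℝ) := by
  unfold loc; fun_prop

theorem contDiff_skew {n : WithTop ℕ∞} : ContDiff ℝ n (skew : Param d → ℝ) := by
  unfold skew; fun_prop

/-- Uniform derivative bounds for the base density, as a function of the whole parameter. -/
theorem CondA5.exists_bound (hA5 : CondA5 f₀ M R) :
    (∀ θ, ContDiffOn ℝ 3 (fun η : Param d => f₀ (θ - loc η) (shape η))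
      (interior (paramSpace M R δ))) ∧
    ∃ C, ∀ θ, ∀ η ∈ interior (paramSpace M R δ), ∀ k : ℕ, 1 ≤ k → k ≤ 3 →
      ‖iteratedFDerivWithin ℝ k (fun η : Param d => f₀ (θ - loc η) (shape η))
        (interior (paramSpace M R δ)) η‖ ≤ C := by
  obtain ⟨hsm, B, hB⟩ := hA5
  set s := interior (M ×ˢ R) with hs
  have hso : IsOpen s := isOpen_interior
  have hpre : IsOpen (locShape d ⁻¹' s) := hso.preimage (locShape d).continuous
  -- Composing with a linear map costs `‖locShape d‖ ^ k`; the maximum with `1`, cubed, covers all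
  -- `k ≤ 3`.
  refine ⟨fun θ => ((hsm θ).mono interior_subset).comp (locShape d).contDiff.contDiffOn
    fun η hη => locShape_mem_interior hη, (max B 0) * (max ‖locShape d‖ 1) ^ 3,
    fun θ η hη k hk1 hk3 => ?_⟩
  have hmem := locShape_mem_interior hη
  have hw := (hsm θ).mono (interior_subset : s ⊆ _)
  have h1 : iteratedFDerivWithin ℝ k (fun η : Param d => f₀ (θ - loc η) (shape η))
      (interior (paramSpace M R δ)) η = iteratedFDerivWithin ℝ k
        ((fun p : ℝ × Shape d => f₀ (θ - p.1) p.2) ∘ locShape d) (locShape d ⁻¹' s) η := by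
    rw [iteratedFDerivWithin_of_isOpen k isOpen_interior hη,
      iteratedFDerivWithin_of_isOpen k hpre hmem]
    rfl
  rw [h1, (locShape d).iteratedFDerivWithin_comp_right hw hso.uniqueDiffOn hpre.uniqueDiffOn hmem
    (by exact_mod_cast hk3)]
  have h2 : iteratedFDerivWithin ℝ k (fun p : ℝ × Shape d => f₀ (θ - p.1) p.2) s (locShape d η) =
      iteratedFDerivWithin ℝ k (fun p : ℝ × Shape d => f₀ (θ - p.1) p.2) (M ×ˢ R)
        (locShape d η) := by
    refine iteratedFDerivWithin_congr_set ?_ k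
    have h3 : s ∈ 𝓝 (locShape d η) := hso.mem_nhds hmem
    exact (eventuallyEq_univ.2 h3).trans
      (eventuallyEq_univ.2 (mem_of_superset h3 interior_subset)).symm
  refine (ContinuousMultilinearMap.norm_compContinuousLinearMap_le _ _).trans ?_
  rw [h2, Finset.prod_const, Finset.card_univ, Fintype.card_fin]
  have h4 := hB θ _ (interior_subset hmem) k hk1 hk3
  have h5 : ‖locShape d‖ ^ k ≤ (max ‖locShape d‖ 1) ^ 3 :=
    (pow_le_pow_left₀ (norm_nonneg _) (le_max_left _ _) k).trans
      (pow_le_pow_right₀ (le_max_right _ _) hk3)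
  exact mul_le_mul (h4.trans (le_max_left _ _)) h5 (by positivity) (le_max_right _ _)

/-- Uniform derivative bounds for the argument of the skewing function. -/
theorem exists_bound_skew_mul_sin {U K : Set (Param d)} (hU : IsOpen U) (hK : IsCompact K)
    (hUK : U ⊆ K) :
    ∃ C, ∀ θ, ∀ η ∈ U, ∀ k : ℕ, k ≤ 3 →
      ‖iteratedFDerivWithin ℝ k (fun η : Param d => skew η * Real.sin (θ - loc η)) U η‖ ≤ C := by
  let a : Param d → ℝ := fun η => skew η * Real.cos (loc η)
  let b : Param d → ℝ := fun η => skew η * Real.sin (loc η)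
  have ha : ContDiff ℝ 3 a :=
    contDiff_skew.mul contDiff_loc.cos
  have hb : ContDiff ℝ 3 b :=
    contDiff_skew.mul contDiff_loc.sin
  obtain ⟨A, hA⟩ := (ha.contDiffOn (s := univ)).exists_norm_iteratedFDerivWithin_le (n := 3)
    isOpen_univ hK (subset_univ _)
  obtain ⟨B, hB⟩ := (hb.contDiffOn (s := univ)).exists_norm_iteratedFDerivWithin_le (n := 3)
    isOpen_univ hK (subset_univ _)
  refine ⟨A + B, fun θ η hη k hk => ?_⟩
  -- The addition formula moves `θ` into coefficients bounded by `1`; `a` and `b` do not depend on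
  -- `θ`, so compactness bounds their derivatives.
  have heq : (fun η : Param d => skew η * Real.sin (θ - loc η)) =
      Real.sin θ • a + (-Real.cos θ) • b := by
    ext η
    simp only [a, b, Pi.add_apply, Pi.smul_apply, smul_eq_mul, Real.sin_sub]
    ring
  have hk' : (k : WithTop ℕ∞) ≤ 3 := by exact_mod_cast hk
  have h1 := hA k hk η (hUK hη)
  have h2 := hB k hk η (hUK hη)
  rw [iteratedFDerivWithin_univ] at h1 h2
  have ha' := (ha.of_le hk').contDiffAt (x := η)
  have hb' := (hb.of_le hk').contDiffAt (x := η)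
  rw [iteratedFDerivWithin_of_isOpen k hU hη, heq,
    iteratedFDeriv_add_apply (f := Real.sin θ • a) (g := (-Real.cos θ) • b)
      (ha'.const_smul (Real.sin θ)) (hb'.const_smul (-Real.cos θ)),
    iteratedFDeriv_const_smul_apply ha', iteratedFDeriv_const_smul_apply hb']
  refine (norm_add_le _ _).trans (add_le_add ?_ ?_)
  · rw [norm_smul]
    calc _ ≤ 1 * ‖_‖ := by gcongr; exact Real.abs_sin_le_one θ
      _ ≤ A := by rwa [one_mul]
  · rw [norm_smul, norm_neg]
    calc _ ≤ 1 * ‖_‖ := by gcongr; exact Real.abs_cos_le_one θ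
      _ ≤ B := by rwa [one_mul]

/-- Around an interior parameter, the log-density is three times continuously differentiable with
derivatives bounded uniformly in the observation. -/
theorem exists_ball_log_density (hm : 0 ≤ m) (hδ : 0 < δ)
    (hf₀ : ∀ ρ ∈ R, IsCircularDensity fun θ => f₀ θ ρ) (hA4 : CondA4 f₀ R) (hA5 : CondA5 f₀ M R)
    {η₀ : Param d} (hη₀ : η₀ ∈ interior (paramSpace M R δ)) :
    ∃ r > 0, Metric.ball η₀ r ⊆ paramSpace M R δ ∧
      (∀ θ, ContDiffOn ℝ 3 (fun η => Real.log (density m f₀ η θ)) (Metric.ball η₀ r)) ∧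
      ∃ C, ∀ θ, ∀ η ∈ Metric.ball η₀ r, ∀ k : ℕ, k ≤ 3 →
        ‖iteratedFDeriv ℝ k (fun η => Real.log (density m f₀ η θ)) η‖ ≤ C := by
  obtain ⟨r, hr, hrH⟩ := Metric.isOpen_iff.1 isOpen_interior η₀ hη₀
  set U := Metric.ball η₀ r with hU
  have hUo : IsOpen U := Metric.isOpen_ball
  have hUH : U ⊆ paramSpace M R δ := hrH.trans interior_subset
  obtain ⟨q, hq, Q, hqQ⟩ := hA4.exists_bounds hf₀
  obtain ⟨hu, Cu, hCu⟩ := hA5.exists_bound (δ := δ)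
  obtain ⟨Cv, hCv⟩ := exists_bound_skew_mul_sin (d := d) hUo (isCompact_closedBall η₀ r)
    Metric.ball_subset_closedBall
  set t : Set (ℝ × ℝ) := Ioi 0 ×ˢ Ioo (-1) 1 with ht
  have hto : IsOpen t := isOpen_Ioi.prod isOpen_Ioo
  set ψ : ℝ × ℝ → ℝ := fun p => Real.log (2 * p.1 * G m p.2) with hψ
  have hψc : ContDiffOn ℝ (3 : ℕ) ψ t := by
    have h1 : ContDiffOn ℝ (3 : ℕ) (fun p : ℝ × ℝ => G m p.2) t :=
      (contDiffOn_G hm 3).comp contDiff_snd.contDiffOn fun p hp => hp.2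
    have h2 : ContDiffOn ℝ (3 : ℕ) (fun p : ℝ × ℝ => 2 * p.1) t := by fun_prop
    refine (h2.mul h1).log fun p hp => ?_
    have h3 : 0 < p.1 := hp.1
    have := G_pos hm ⟨hp.2.1, hp.2.2.le⟩
    positivity
  obtain ⟨Cψ, hCψ⟩ := hψc.exists_norm_iteratedFDerivWithin_le hto
    (K := Icc q Q ×ˢ Icc (-1 + δ) (1 - δ)) (isCompact_Icc.prod isCompact_Icc)
    (prod_mono (fun x hx => hq.trans_le hx.1) (Icc_subset_Ioo_of_pos hδ))
  set Φ : ℝ → Param d → ℝ × ℝ := fun θ η =>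
    (f₀ (θ - loc η) (shape η), skew η * Real.sin (θ - loc η)) with hΦ
  have hcomp : ∀ θ, (fun η => Real.log (density m f₀ η θ)) = ψ ∘ Φ θ := fun θ => rfl
  have hu' : ∀ θ, ContDiffOn ℝ 3 (fun η : Param d => f₀ (θ - loc η) (shape η)) U :=
    fun θ => (hu θ).mono hrH
  have hv' : ∀ θ, ContDiffOn ℝ 3 (fun η : Param d => skew η * Real.sin (θ - loc η)) U :=
    fun θ => (contDiff_skew.mul (contDiff_const.sub contDiff_loc).sin).contDiffOn
  have hΦc : ∀ θ, ContDiffOn ℝ 3 (Φ θ) U := fun θ => (hu' θ).prodMk (hv' θ)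
  have hmaps' : ∀ θ, ∀ η ∈ U, Φ θ η ∈ Icc q Q ×ˢ Icc (-1 + δ) (1 - δ) := fun θ η hη =>
    ⟨hqQ _ _ (hUH hη).2.1, mul_sin_mem_Icc (hUH hη).2.2 _⟩
  have hmaps : ∀ θ, MapsTo (Φ θ) U t := fun θ η hη =>
    prod_mono (fun x hx => hq.trans_le hx.1) (Icc_subset_Ioo_of_pos hδ) (hmaps' θ η hη)
  -- The composition estimate `k! C D ^ k` needs the `i`-th derivative of `Φ θ` to be at most `D ^
  -- i`; a bound by `D` implies this once `D ≥ 1`.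
  set D := max (max Cu Cv) 1 with hD
  have hD1 : 1 ≤ D := le_max_right _ _
  refine ⟨r, hr, hUH, fun θ => ?_, (Nat.factorial 3 : ℝ) * Cψ * D ^ 3, fun θ η hη k hk => ?_⟩
  · rw [hcomp]
    exact hψc.comp (hΦc θ) (hmaps θ)
  · rw [hcomp, ← iteratedFDerivWithin_of_isOpen k hUo hη]
    have hCψ0 : 0 ≤ Cψ := (norm_nonneg _).trans (hCψ 0 (by norm_num) _ (hmaps' θ η hη))
    have h := norm_iteratedFDerivWithin_comp_le (n := k) (D := D) hψc (hΦc θ)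
      (by exact_mod_cast hk) hto.uniqueDiffOn hUo.uniqueDiffOn (hmaps θ) hη
      (fun i hi => hCψ i (hi.trans hk) _ (hmaps' θ η hη)) (fun i hi1 hik => by
        have hi3 := hik.trans hk
        rw [hΦ, iteratedFDerivWithin_prodMk (hu' θ η hη) (hv' θ η hη) hUo.uniqueDiffOn hη
          (by exact_mod_cast hi3), ContinuousMultilinearMap.opNorm_prod]
        have h1 := hCu θ η (hrH hη) i hi1 hi3
        rw [iteratedFDerivWithin_of_isOpen i isOpen_interior (hrH hη),
          ← iteratedFDerivWithin_of_isOpen i hUo hη] at h1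
        refine (max_le_max h1 (hCv θ η hη i hi3)).trans
          ((le_max_left _ (1 : ℝ)).trans ?_)
        exact le_self_pow₀ hD1 (by omega))
    refine h.trans ?_
    have h1 : (k.factorial : ℝ) ≤ (Nat.factorial 3 : ℝ) := by
      exact_mod_cast Nat.factorial_le hk
    have h2 : D ^ k ≤ D ^ 3 := pow_le_pow_right₀ hD1 hk
    gcongr

end ESS

/-! ### Regular log-densities: measurability, Taylor bounds, score identities. -/

/-- Directional derivatives of a family of functions depend measurably on the parameter. -/
theorem measurable_fderiv_apply_of_isOpen {T E : Type*} [MeasurableSpace T] [NormedAddCommGroup E]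
    [NormedSpace ℝ E] {f : T → E → ℝ} {U : Set E} (hU : IsOpen U)
    (hf : ∀ x ∈ U, Measurable fun t => f t x) {x : E} (hx : x ∈ U)
    (hd : ∀ t, DifferentiableAt ℝ (f t) x) (v : E) :
    Measurable fun t => fderiv ℝ (f t) x v := by
  have hc0 : Tendsto (fun n : ℕ => 1 / ((n : ℝ) + 1)) atTop (𝓝 0) :=
    tendsto_one_div_add_atTop_nhds_zero_nat
  have hev : ∀ᶠ n : ℕ in atTop, x + (1 / ((n : ℝ) + 1)) • v ∈ U := by
    have h : Tendsto (fun n : ℕ => x + (1 / ((n : ℝ) + 1)) • v) atTop (𝓝 x) := by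
      simpa using (hc0.smul_const v).const_add x
    exact h (hU.mem_nhds hx)
  obtain ⟨N, hN⟩ := eventually_atTop.1 hev
  -- Shifting by `N` keeps every `x + c n • v` in `U`, where measurability is available; the
  -- derivative is a limit of these difference quotients.
  set c : ℕ → ℝ := fun n => 1 / (((n + N : ℕ) : ℝ) + 1) with hc
  have hcpos : ∀ n, 0 < c n := fun n => by positivity
  have hclim : Tendsto c atTop (𝓝[≠] 0) :=
    tendsto_nhdsWithin_iff.2 ⟨hc0.comp (tendsto_add_atTop_nat N),
      Eventually.of_forall fun n => (hcpos n).ne'⟩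
  refine measurable_of_tendsto_metrizable
    (f := fun n t => (c n)⁻¹ • (f t (x + c n • v) - f t x)) (fun n => ?_) ?_
  · exact ((hf _ (hN (n + N) (by omega))).sub (hf x hx)).const_smul (c n)⁻¹
  · refine tendsto_pi_nhds.2 fun t => ?_
    have h := ((hd t).hasFDerivAt.hasLineDerivAt v).tendsto_slope_zero.comp hclim
    simpa [Function.comp_def] using h

/-- If the integral of a bounded family is constant, then that of its derivative is zero. -/
theorem integral_deriv_eq_zero_of_integral_eq_const {T : Type*} [MeasurableSpace T]
    {ν : Measure T} [IsFiniteMeasure ν] {g g' : T → ℝ → ℝ} {I : Set ℝ} {B B' c : ℝ}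
    (hI : IsOpen I) (hm : ∀ s ∈ I, Measurable fun t => g t s)
    (hm' : ∀ s ∈ I, Measurable fun t => g' t s) (hb : ∀ t, ∀ s ∈ I, ‖g t s‖ ≤ B)
    (hb' : ∀ t, ∀ s ∈ I, ‖g' t s‖ ≤ B') (hd : ∀ t, ∀ s ∈ I, HasDerivAt (g t) (g' t s) s)
    (hc : ∀ s ∈ I, ∫ t, g t s ∂ν = c) : ∀ s ∈ I, ∫ t, g' t s ∂ν = 0 := by
  intro s hs
  have hIs := hI.mem_nhds hs
  have h := hasDerivAt_integral_of_dominated_loc_of_deriv_le (μ := ν) (F := fun s t => g t s)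
    (F' := fun s t => g' t s) (bound := fun _ => B') hIs
    (by filter_upwards [hIs] with x hx using (hm x hx).aestronglyMeasurable)
    (Integrable.of_bound (hm s hs).aestronglyMeasurable B (ae_of_all _ fun t => hb t s hs))
    (hm' s hs).aestronglyMeasurable (ae_of_all _ hb') (integrable_const _) (ae_of_all _ hd)
  refine h.2.unique ?_
  refine (hasDerivAt_const s c).congr_of_eventuallyEq ?_
  filter_upwards [hIs] with x hx using hc x hx

/-- Second-order Taylor bound on a ball. -/
theorem norm_sub_sub_fderiv_le_of_iteratedFDeriv_two_le {E W : Type*} [NormedAddCommGroup E]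
    [NormedSpace ℝ E] [NormedAddCommGroup W] [NormedSpace ℝ W] {f : E → W} {x₀ x : E} {r C : ℝ}
    (hf : ∀ y ∈ Metric.ball x₀ r, ContDiffAt ℝ 2 f y)
    (hC : ∀ y ∈ Metric.ball x₀ r, ‖iteratedFDeriv ℝ 2 f y‖ ≤ C) (hx : x ∈ Metric.ball x₀ r) :
    ‖f x - f x₀ - fderiv ℝ f x₀ (x - x₀)‖ ≤ C * ‖x - x₀‖ ^ 2 := by
  have hr : 0 < r := dist_nonneg.trans_lt (Metric.mem_ball.1 hx)
  have hx₀ : x₀ ∈ Metric.ball x₀ r := Metric.mem_ball_self hr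
  have hC0 : 0 ≤ C := (norm_nonneg _).trans (hC x₀ hx₀)
  have hseg : segment ℝ x₀ x ⊆ Metric.ball x₀ r := (convex_ball x₀ r).segment_subset hx₀ hx
  -- The mean value inequality is used twice: first for `fderiv ℝ f`, then for `f` minus its linear
  -- part. This loses the factor `1/2`, which is immaterial.
  have h1 := (convex_segment x₀ x).norm_image_sub_le_of_norm_fderiv_le' (𝕜 := ℝ)
    (f := f) (φ := fderiv ℝ f x₀) (C := C * ‖x - x₀‖)
    (fun y hy => (hf y (hseg hy)).differentiableAt (by norm_num)) (fun y hy => by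
      have h2 := (convex_ball x₀ r).norm_image_sub_le_of_norm_fderiv_le (𝕜 := ℝ) (f := fderiv ℝ f)
        (C := C) (fun y hy => ((hf y hy).fderiv_right (m := 1) (by norm_num)).differentiableAt
          (by norm_num)) (fun y hy => by
            rw [← norm_iteratedFDeriv_one, norm_iteratedFDeriv_fderiv]
            exact hC y hy) hx₀ (hseg hy)
      refine h2.trans ?_
      gcongr
      rw [← dist_eq_norm, ← dist_eq_norm, dist_comm y, dist_comm x]
      have := dist_add_dist_of_mem_segment hy
      linarith [dist_nonneg (x := y) (y := x)])
    (left_mem_segment ℝ x₀ x) (right_mem_segment ℝ x₀ x)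
  exact h1.trans (le_of_eq (by ring))

/-- A family of log-densities `F t` with respect to a measure `ν` that is three times continuously
differentiable in the parameter on a ball, with uniformly bounded derivatives. -/
structure IsRegularLogDensity {T E : Type*} [MeasurableSpace T] [NormedAddCommGroup E]
    [NormedSpace ℝ E] (ν : Measure T) (F : T → E → ℝ) (x₀ : E) (r C : ℝ) : Prop where
  radius_pos : 0 < r
  contDiffOn : ∀ t, ContDiffOn ℝ 3 (F t) (Metric.ball x₀ r)
  bound : ∀ t, ∀ x ∈ Metric.ball x₀ r, ∀ k : ℕ, k ≤ 3 → ‖iteratedFDeriv ℝ k (F t) x‖ ≤ C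
  measurable : ∀ x ∈ Metric.ball x₀ r, Measurable fun t => F t x
  integral_exp : ∀ x ∈ Metric.ball x₀ r, ∫ t, Real.exp (F t x) ∂ν = 1

namespace IsRegularLogDensity

section Normed

variable {T E : Type*} [MeasurableSpace T] [NormedAddCommGroup E] [NormedSpace ℝ E]
  {ν : Measure T} {F : T → E → ℝ} {x₀ x : E} {r C : ℝ}

theorem mem_ball (h : IsRegularLogDensity ν F x₀ r C) : x₀ ∈ Metric.ball x₀ r :=
  Metric.mem_ball_self h.radius_pos

theorem contDiffAt (h : IsRegularLogDensity ν F x₀ r C) (t : T) (hx : x ∈ Metric.ball x₀ r) :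
    ContDiffAt ℝ 3 (F t) x :=
  (h.contDiffOn t).contDiffAt (Metric.isOpen_ball.mem_nhds hx)

theorem differentiableAt (h : IsRegularLogDensity ν F x₀ r C) (t : T)
    (hx : x ∈ Metric.ball x₀ r) : DifferentiableAt ℝ (F t) x :=
  (h.contDiffAt t hx).differentiableAt (by norm_num)

theorem contDiffAt_fderiv (h : IsRegularLogDensity ν F x₀ r C) (t : T)
    (hx : x ∈ Metric.ball x₀ r) : ContDiffAt ℝ 2 (fderiv ℝ (F t)) x :=
  (h.contDiffAt t hx).fderiv_right (by norm_num)

theorem differentiableAt_fderiv (h : IsRegularLogDensity ν F x₀ r C) (t : T)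
    (hx : x ∈ Metric.ball x₀ r) : DifferentiableAt ℝ (fderiv ℝ (F t)) x :=
  (h.contDiffAt_fderiv t hx).differentiableAt (by norm_num)

theorem norm_le (h : IsRegularLogDensity ν F x₀ r C) (t : T) (hx : x ∈ Metric.ball x₀ r) :
    ‖F t x‖ ≤ C := by
  simpa using h.bound t x hx 0 (by norm_num)

theorem norm_fderiv_le (h : IsRegularLogDensity ν F x₀ r C) (t : T)
    (hx : x ∈ Metric.ball x₀ r) : ‖fderiv ℝ (F t) x‖ ≤ C := by
  rw [← norm_iteratedFDeriv_one]
  exact h.bound t x hx 1 (by norm_num)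

theorem norm_fderiv_fderiv_le (h : IsRegularLogDensity ν F x₀ r C) (t : T)
    (hx : x ∈ Metric.ball x₀ r) : ‖fderiv ℝ (fderiv ℝ (F t)) x‖ ≤ C := by
  rw [← norm_iteratedFDeriv_one, norm_iteratedFDeriv_fderiv]
  exact h.bound t x hx 2 (by norm_num)

theorem norm_fderiv_apply_le (h : IsRegularLogDensity ν F x₀ r C) (t : T)
    (hx : x ∈ Metric.ball x₀ r) (v : E) : ‖fderiv ℝ (F t) x v‖ ≤ C * ‖v‖ :=
  (fderiv ℝ (F t) x).le_of_opNorm_le (h.norm_fderiv_le t hx) v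

theorem norm_fderiv_fderiv_apply_le (h : IsRegularLogDensity ν F x₀ r C) (t : T)
    (hx : x ∈ Metric.ball x₀ r) (v w : E) :
    ‖fderiv ℝ (fderiv ℝ (F t)) x v w‖ ≤ C * ‖v‖ * ‖w‖ :=
  (fderiv ℝ (fderiv ℝ (F t)) x).le_of_opNorm₂_le_of_le (h.norm_fderiv_fderiv_le t hx) le_rfl le_rfl

/-- Second-order Taylor bound for the score. -/
theorem norm_fderiv_sub_le (h : IsRegularLogDensity ν F x₀ r C) (t : T)
    (hx : x ∈ Metric.ball x₀ r) :
    ‖fderiv ℝ (F t) x - fderiv ℝ (F t) x₀ - fderiv ℝ (fderiv ℝ (F t)) x₀ (x - x₀)‖ ≤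
      C * ‖x - x₀‖ ^ 2 :=
  norm_sub_sub_fderiv_le_of_iteratedFDeriv_two_le (fun _ hy => h.contDiffAt_fderiv t hy)
    (fun y hy => by
      rw [norm_iteratedFDeriv_fderiv]
      exact h.bound t y hy 3 (by norm_num)) hx

theorem measurable_fderiv_apply (h : IsRegularLogDensity ν F x₀ r C)
    (hx : x ∈ Metric.ball x₀ r) (v : E) : Measurable fun t => fderiv ℝ (F t) x v :=
  measurable_fderiv_apply_of_isOpen Metric.isOpen_ball h.measurable hx
    (fun t => h.differentiableAt t hx) v

theorem measurable_fderiv_fderiv_apply (h : IsRegularLogDensity ν F x₀ r C)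
    (hx : x ∈ Metric.ball x₀ r) (v w : E) :
    Measurable fun t => fderiv ℝ (fderiv ℝ (F t)) x v w := by
  have h1 := measurable_fderiv_apply_of_isOpen (f := fun t y => fderiv ℝ (F t) y w)
    Metric.isOpen_ball (fun y hy => h.measurable_fderiv_apply hy w) hx
    (fun t => (h.differentiableAt_fderiv t hx).clm_apply (differentiableAt_const w)) v
  have h2 : ∀ t, fderiv ℝ (fun y => fderiv ℝ (F t) y w) x v =
      fderiv ℝ (fderiv ℝ (F t)) x v w := fun t => by
    rw [fderiv_clm_apply (h.differentiableAt_fderiv t hx) (differentiableAt_const w)]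
    simp
  simpa only [h2] using h1

/-- The score has mean zero, and its second moments are given by the negative expected Hessian. -/
theorem integral_exp_mul_fderiv [IsFiniteMeasure ν] (h : IsRegularLogDensity ν F x₀ r C) (v : E) :
    ∫ t, Real.exp (F t x₀) * fderiv ℝ (F t) x₀ v ∂ν = 0 ∧
      ∫ t, Real.exp (F t x₀) *
        (fderiv ℝ (F t) x₀ v ^ 2 + fderiv ℝ (fderiv ℝ (F t)) x₀ v v) ∂ν = 0 := by
  have hline : ∀ s : ℝ, HasDerivAt (fun s : ℝ => x₀ + s • v) v s := fun s => by
    simpa using ((hasDerivAt_id s).smul_const v).const_add x₀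
  -- On the line through `x₀` along `v` the identities reduce to differentiating `∫ exp F = 1` twice
  -- in one real variable.
  set I : Set ℝ := (fun s : ℝ => x₀ + s • v) ⁻¹' Metric.ball x₀ r with hI
  have hIo : IsOpen I := Metric.isOpen_ball.preimage (by fun_prop)
  have h0 : (0 : ℝ) ∈ I := by simpa [hI] using h.radius_pos
  have hexp : ∀ t, ∀ s ∈ I, Real.exp (F t (x₀ + s • v)) ≤ Real.exp C := fun t s hs =>
    Real.exp_le_exp.2 ((le_abs_self _).trans (h.norm_le t hs))
  have hd1 : ∀ t, ∀ s ∈ I, HasDerivAt (fun s : ℝ => Real.exp (F t (x₀ + s • v)))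
      (Real.exp (F t (x₀ + s • v)) * fderiv ℝ (F t) (x₀ + s • v) v) s := fun t s hs => by
    have h1 : HasDerivAt (fun s : ℝ => F t (x₀ + s • v)) (fderiv ℝ (F t) (x₀ + s • v) v) s :=
      HasFDerivAt.comp_hasDerivAt s (h.differentiableAt t hs).hasFDerivAt (hline s)
    exact h1.exp
  have hd2 : ∀ t, ∀ s ∈ I, HasDerivAt
      (fun s : ℝ => Real.exp (F t (x₀ + s • v)) * fderiv ℝ (F t) (x₀ + s • v) v)
      (Real.exp (F t (x₀ + s • v)) * (fderiv ℝ (F t) (x₀ + s • v) v ^ 2 +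
        fderiv ℝ (fderiv ℝ (F t)) (x₀ + s • v) v v)) s := fun t s hs => by
    have h1 : HasDerivAt (fun s : ℝ => fderiv ℝ (F t) (x₀ + s • v))
        (fderiv ℝ (fderiv ℝ (F t)) (x₀ + s • v) v) s :=
      HasFDerivAt.comp_hasDerivAt s (h.differentiableAt_fderiv t hs).hasFDerivAt (hline s)
    have h2 : HasDerivAt (fun s : ℝ => fderiv ℝ (F t) (x₀ + s • v) v)
        (fderiv ℝ (fderiv ℝ (F t)) (x₀ + s • v) v v) s := by
      simpa using h1.clm_apply (hasDerivAt_const s v)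
    exact ((hd1 t s hs).mul h2).congr_deriv (by ring)
  have hm0 : ∀ s ∈ I, Measurable fun t => Real.exp (F t (x₀ + s • v)) := fun s hs =>
    (h.measurable _ hs).exp
  have hm1 : ∀ s ∈ I, Measurable fun t =>
      Real.exp (F t (x₀ + s • v)) * fderiv ℝ (F t) (x₀ + s • v) v := fun s hs =>
    (hm0 s hs).mul (h.measurable_fderiv_apply hs v)
  have hm2 : ∀ s ∈ I, Measurable fun t => Real.exp (F t (x₀ + s • v)) *
      (fderiv ℝ (F t) (x₀ + s • v) v ^ 2 + fderiv ℝ (fderiv ℝ (F t)) (x₀ + s • v) v v) :=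
    fun s hs => (hm0 s hs).mul (((h.measurable_fderiv_apply hs v).pow_const 2).add
      (h.measurable_fderiv_fderiv_apply hs v v))
  have hb0 : ∀ t, ∀ s ∈ I, ‖Real.exp (F t (x₀ + s • v))‖ ≤ Real.exp C := fun t s hs => by
    rw [Real.norm_of_nonneg (Real.exp_pos _).le]
    exact hexp t s hs
  have hb1 : ∀ t, ∀ s ∈ I, ‖Real.exp (F t (x₀ + s • v)) * fderiv ℝ (F t) (x₀ + s • v) v‖ ≤
      Real.exp C * (C * ‖v‖) := fun t s hs => by
    rw [norm_mul]
    exact mul_le_mul (hb0 t s hs) (h.norm_fderiv_apply_le t hs v) (norm_nonneg _) (Real.exp_pos _).le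
  have hb2 : ∀ t, ∀ s ∈ I, ‖Real.exp (F t (x₀ + s • v)) * (fderiv ℝ (F t) (x₀ + s • v) v ^ 2 +
      fderiv ℝ (fderiv ℝ (F t)) (x₀ + s • v) v v)‖ ≤
      Real.exp C * ((C * ‖v‖) ^ 2 + C * ‖v‖ * ‖v‖) := fun t s hs => by
    rw [norm_mul]
    refine mul_le_mul (hb0 t s hs) ((norm_add_le _ _).trans (add_le_add ?_
      (h.norm_fderiv_fderiv_apply_le t hs v v))) (norm_nonneg _) (Real.exp_pos _).le
    rw [norm_pow]
    exact pow_le_pow_left₀ (norm_nonneg _) (h.norm_fderiv_apply_le t hs v) 2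
  have key1 := integral_deriv_eq_zero_of_integral_eq_const (ν := ν) hIo hm0 hm1 hb0 hb1 hd1
    (fun s hs => h.integral_exp _ hs)
  -- The first identity holds on all of `I`, so it is again a constant integral that can be
  -- differentiated.
  have key2 := integral_deriv_eq_zero_of_integral_eq_const (ν := ν) hIo hm1 hm2 hb1 hb2 hd2 key1
  exact ⟨by simpa using key1 0 h0, by simpa using key2 0 h0⟩

end Normed

end IsRegularLogDensity

/-! ### Score, Hessian and information matrix; asymptotic normality. -/

theorem ContinuousLinearMap.apply_apply_eq_dotProduct_mulVec {ι : Type*} [Fintype ι]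
    [DecidableEq ι] (B : EuclideanSpace ℝ ι →L[ℝ] EuclideanSpace ℝ ι →L[ℝ] ℝ)
    (x y : EuclideanSpace ℝ ι) :
    B x y = x ⬝ᵥ (Matrix.of fun i j => B (EuclideanSpace.single i 1)
      (EuclideanSpace.single j 1)).mulVec y := by
  have hsum : ∀ z : EuclideanSpace ℝ ι, z = ∑ i, z i • EuclideanSpace.single i (1 : ℝ) := by
    intro z
    have := (EuclideanSpace.basisFun ι ℝ).sum_repr z
    simpa using this.symm
  conv_lhs => rw [hsum x, hsum y]
  simp only [map_sum, map_smul, sum_apply, smul_apply, smul_eq_mul,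
    dotProduct, Matrix.mulVec, Matrix.of_apply, Finset.mul_sum]
  rw [Finset.sum_comm]
  refine Finset.sum_congr rfl fun i _ => Finset.sum_congr rfl fun j _ => ?_
  ring

/-- **Strong law of large numbers** for matrices with bounded entries. -/
theorem ae_tendsto_average_matrix {T Ω ι κ : Type*} [Countable ι] [Countable κ]
    [MeasurableSpace T] [MeasurableSpace Ω] {P : Measure Ω} [IsProbabilityMeasure P]
    {μ : Measure T} {A : T → Matrix ι κ ℝ} {C : ℝ} (hA : ∀ i j, Measurable fun t => A t i j)
    (hC : ∀ t i j, ‖A t i j‖ ≤ C) {X : ℕ → Ω → T} (hindep : iIndepFun X P)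
    (hlaw : ∀ i, HasLaw (X i) μ P) :
    ∀ᵐ ω ∂P, Tendsto (fun n : ℕ => (n : ℝ)⁻¹ • ∑ k ∈ Finset.range n, A (X k ω)) atTop
      (𝓝 (Matrix.of fun i j => ∫ t, A t i j ∂μ)) := by
  have hentry : ∀ i j, ∀ᵐ ω ∂P, Tendsto
      (fun n : ℕ => (n : ℝ)⁻¹ • ∑ k ∈ Finset.range n, A (X k ω) i j) atTop
      (𝓝 (∫ t, A t i j ∂μ)) := by
    intro i j
    have h := strong_law_ae (μ := P) (fun k ω => A (X k ω) i j)
      (Integrable.of_bound ((hA i j).comp_aemeasurable (hlaw 0).aemeasurable).aestronglyMeasurable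
        C (ae_of_all _ fun ω => hC _ i j))
      (fun k l hkl => (hindep.indepFun hkl).comp (hA i j) (hA i j))
      (fun k => IdentDistrib.comp ⟨(hlaw k).aemeasurable, (hlaw 0).aemeasurable,
        by rw [(hlaw k).map_eq, (hlaw 0).map_eq]⟩ (hA i j))
    rwa [← integral_map (hlaw 0).aemeasurable (hA i j).aestronglyMeasurable,
      (hlaw 0).map_eq] at h
  filter_upwards [ae_all_iff.2 fun i => ae_all_iff.2 fun j => hentry i j] with ω hω
  refine tendsto_pi_nhds.2 fun i => tendsto_pi_nhds.2 fun j => ?_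
  simpa [Matrix.sum_apply] using hω i j

namespace IsRegularLogDensity

variable {T ι : Type*} [Fintype ι] {F : T → EuclideanSpace ℝ ι → ℝ} {x₀ x : EuclideanSpace ℝ ι} {r C : ℝ}

/-- The score vector of a parametric log-density. -/
noncomputable def score (F : T → EuclideanSpace ℝ ι → ℝ) (x₀ : EuclideanSpace ℝ ι) (t : T) :
    EuclideanSpace ℝ ι :=
  (InnerProductSpace.toDual ℝ _).symm (fderiv ℝ (F t) x₀)

theorem inner_score (t : T) (v : EuclideanSpace ℝ ι) :
    inner ℝ (score F x₀ t) v = fderiv ℝ (F t) x₀ v :=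
  InnerProductSpace.toDual_symm_apply

theorem norm_score_le [MeasurableSpace T] {ν : Measure T}
    (h : IsRegularLogDensity ν F x₀ r C) (t : T) :
    ‖score F x₀ t‖ ≤ C := by
  rw [score, LinearIsometryEquiv.norm_map]
  exact h.norm_fderiv_le t h.mem_ball

theorem integral_inner_score [MeasurableSpace T] {ν μ : Measure T} [IsFiniteMeasure ν]
    (h : IsRegularLogDensity ν F x₀ r C)
    (hμ : ∀ f : T → ℝ, ∫ t, f t ∂μ = ∫ t, Real.exp (F t x₀) * f t ∂ν)
    (v : EuclideanSpace ℝ ι) : ∫ t, inner ℝ (score F x₀ t) v ∂μ = 0 := by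
  simp only [inner_score, hμ]
  exact (h.integral_exp_mul_fderiv v).1

variable [DecidableEq ι]

/-- The Hessian matrix of a parametric log-density. -/
noncomputable def hessian (F : T → EuclideanSpace ℝ ι → ℝ) (x₀ : EuclideanSpace ℝ ι) (t : T) :
    Matrix ι ι ℝ :=
  Matrix.of fun i j => iteratedFDeriv ℝ 2 (F t) x₀
    ![EuclideanSpace.single i (1 : ℝ), EuclideanSpace.single j (1 : ℝ)]

theorem hessian_apply (t : T) (i j : ι) : hessian F x₀ t i j =
    fderiv ℝ (fderiv ℝ (F t)) x₀ (EuclideanSpace.single i 1) (EuclideanSpace.single j 1) := by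
  simp [hessian, iteratedFDeriv_two_apply]

theorem dotProduct_hessian_mulVec (t : T) (v w : EuclideanSpace ℝ ι) :
    v ⬝ᵥ (hessian F x₀ t).mulVec w = fderiv ℝ (fderiv ℝ (F t)) x₀ v w := by
  rw [ContinuousLinearMap.apply_apply_eq_dotProduct_mulVec]
  congr 2
  ext i j
  rw [hessian_apply, Matrix.of_apply]

variable [MeasurableSpace T] {ν μ : Measure T}

/-- The negative expected Hessian of a parametric log-density. -/
noncomputable def information (μ : Measure T) (F : T → EuclideanSpace ℝ ι → ℝ)
    (x₀ : EuclideanSpace ℝ ι) : Matrix ι ι ℝ :=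
  Matrix.of fun i j => -∫ t, hessian F x₀ t i j ∂μ

theorem hessian_comm (h : IsRegularLogDensity ν F x₀ r C) (t : T) (i j : ι) :
    hessian F x₀ t i j = hessian F x₀ t j i := by
  rw [hessian_apply, hessian_apply]
  exact (h.contDiffAt t h.mem_ball).isSymmSndFDerivAt
    (by rw [minSmoothness_of_isRCLikeNormedField]; norm_num) _ _

/-- The matrix acts on the second slot of the second derivative and the Riesz representation fixes
the first; symmetry of the second derivative reconciles them. -/
theorem toEuclideanCLM_hessian_apply (h : IsRegularLogDensity ν F x₀ r C) (t : T)
    (v : EuclideanSpace ℝ ι) : Matrix.toEuclideanCLM (𝕜 := ℝ) (hessian F x₀ t) v =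
      (InnerProductSpace.toDual ℝ _).symm (fderiv ℝ (fderiv ℝ (F t)) x₀ v) := by
  refine ext_inner_right ℝ fun w => ?_
  rw [InnerProductSpace.toDual_symm_apply, real_inner_comm, Matrix.inner_toEuclideanCLM,
    dotProduct_hessian_mulVec]
  exact (h.contDiffAt t h.mem_ball).isSymmSndFDerivAt
    (by rw [minSmoothness_of_isRCLikeNormedField]; norm_num) _ _

theorem measurable_score (h : IsRegularLogDensity ν F x₀ r C) : Measurable (score F x₀) := by
  have h1 : score F x₀ = fun t => WithLp.toLp 2 fun i =>
      fderiv ℝ (F t) x₀ (EuclideanSpace.single i 1) := by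
    ext t i
    have := inner_score (F := F) (x₀ := x₀) t (EuclideanSpace.single i 1)
    simpa [EuclideanSpace.inner_single_right] using this
  rw [h1]
  exact (WithLp.measurable_toLp 2 _).comp
    (measurable_pi_lambda _ fun i => h.measurable_fderiv_apply h.mem_ball _)

theorem measurable_hessian (h : IsRegularLogDensity ν F x₀ r C) (i j : ι) :
    Measurable fun t => hessian F x₀ t i j := by
  simp only [hessian_apply]
  exact h.measurable_fderiv_fderiv_apply h.mem_ball _ _

theorem norm_hessian_le (h : IsRegularLogDensity ν F x₀ r C) (t : T) (i j : ι) :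
    ‖hessian F x₀ t i j‖ ≤ C := by
  rw [hessian_apply]
  simpa using h.norm_fderiv_fderiv_apply_le t h.mem_ball (EuclideanSpace.single i 1)
    (EuclideanSpace.single j 1)

/-- The remainder of the linearized score. -/
theorem norm_score_add_hessian_sub_le (h : IsRegularLogDensity ν F x₀ r C) (t : T)
    (hx : x ∈ Metric.ball x₀ r) :
    ‖score F x₀ t + Matrix.toEuclideanCLM (𝕜 := ℝ) (hessian F x₀ t) (x - x₀) - score F x t‖ ≤
      C * ‖x - x₀‖ ^ 2 := by
  rw [h.toEuclideanCLM_hessian_apply, score, score, ← map_add, ← map_sub,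
    LinearIsometryEquiv.norm_map]
  refine le_trans (le_of_eq ?_) (h.norm_fderiv_sub_le t hx)
  rw [← norm_neg]
  congr 1
  abel

theorem integrable_hessian [IsFiniteMeasure μ] (h : IsRegularLogDensity ν F x₀ r C) (i j : ι) :
    Integrable (fun t => hessian F x₀ t i j) μ :=
  Integrable.of_bound (h.measurable_hessian i j).aestronglyMeasurable C
    (ae_of_all _ fun t => h.norm_hessian_le t i j)

theorem dotProduct_information_mulVec [IsFiniteMeasure μ]
    (h : IsRegularLogDensity ν F x₀ r C) (v w : EuclideanSpace ℝ ι) :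
    v ⬝ᵥ (information μ F x₀).mulVec w = -∫ t, fderiv ℝ (fderiv ℝ (F t)) x₀ v w ∂μ := by
  simp only [← dotProduct_hessian_mulVec, dotProduct, Matrix.mulVec, information, Matrix.of_apply,
    Finset.mul_sum]
  rw [integral_finsetSum]
  · simp_rw [← Finset.sum_neg_distrib]
    refine Finset.sum_congr rfl fun i _ => ?_
    rw [integral_finsetSum, ← Finset.sum_neg_distrib]
    · refine Finset.sum_congr rfl fun j _ => ?_
      rw [integral_const_mul, integral_mul_const]
      ring
    · exact fun j _ => ((h.integrable_hessian i j).mul_const _).const_mul _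
  · exact fun i _ => integrable_finsetSum _ fun j _ =>
      ((h.integrable_hessian i j).mul_const _).const_mul _

/-- The information identity. -/
theorem integral_inner_score_sq [IsFiniteMeasure ν] [IsFiniteMeasure μ]
    (h : IsRegularLogDensity ν F x₀ r C)
    (hμ : ∀ f : T → ℝ, ∫ t, f t ∂μ = ∫ t, Real.exp (F t x₀) * f t ∂ν)
    (v : EuclideanSpace ℝ ι) :
    ∫ t, inner ℝ (score F x₀ t) v ^ 2 ∂μ = v ⬝ᵥ (information μ F x₀).mulVec v := by
  rw [h.dotProduct_information_mulVec, eq_neg_iff_add_eq_zero]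
  simp only [inner_score]
  have h1 : Integrable (fun t => fderiv ℝ (F t) x₀ v ^ 2) μ :=
    Integrable.of_bound ((h.measurable_fderiv_apply h.mem_ball v).pow_const 2).aestronglyMeasurable
      ((C * ‖v‖) ^ 2) (ae_of_all _ fun t => by
        rw [norm_pow]
        exact pow_le_pow_left₀ (norm_nonneg _) (h.norm_fderiv_apply_le t h.mem_ball v) 2)
  have h2 : Integrable (fun t => fderiv ℝ (fderiv ℝ (F t)) x₀ v v) μ :=
    Integrable.of_bound (h.measurable_fderiv_fderiv_apply h.mem_ball v v).aestronglyMeasurable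
      (C * ‖v‖ * ‖v‖) (ae_of_all _ fun t => h.norm_fderiv_fderiv_apply_le t h.mem_ball v v)
  rw [← integral_add h1 h2, hμ]
  exact (h.integral_exp_mul_fderiv v).2

/-- By the information identity the quadratic form is a second moment of the score. -/
theorem posSemidef_information [IsFiniteMeasure ν] [IsFiniteMeasure μ]
    (h : IsRegularLogDensity ν F x₀ r C)
    (hμ : ∀ f : T → ℝ, ∫ t, f t ∂μ = ∫ t, Real.exp (F t x₀) * f t ∂ν) :
    (information μ F x₀).PosSemidef := by
  refine Matrix.PosSemidef.of_dotProduct_mulVec_nonneg ?_ fun x => ?_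
  · ext i j
    simp only [information, Matrix.conjTranspose_apply, Matrix.of_apply, star_trivial]
    simp only [h.hessian_comm _ j i]
  · have := h.integral_inner_score_sq hμ (WithLp.toLp 2 x)
    simp only [star_trivial]
    rw [← this]
    positivity

/-- **Asymptotic normality of maximum likelihood estimators** in a regular family: a strongly
consistent sequence of maximizers of the likelihood is asymptotically normal, with covariance the
inverse of the information matrix. -/
theorem tendstoInDistribution_maximizer [IsFiniteMeasure ν] {Ω : Type*} [MeasurableSpace Ω]
    {P : Measure Ω} [IsProbabilityMeasure P] (h : IsRegularLogDensity ν F x₀ r C)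
    (hμ : ∀ f : T → ℝ, ∫ t, f t ∂μ = ∫ t, Real.exp (F t x₀) * f t ∂ν)
    {X : ℕ → Ω → T} (hindep : iIndepFun X P) (hlaw : ∀ i, HasLaw (X i) μ P)
    {e : ℕ → Ω → EuclideanSpace ℝ ι} (he : ∀ n, AEMeasurable (e n) P)
    (hcons : ∀ᵐ ω ∂P, Tendsto (fun n => e n ω) atTop (𝓝 x₀))
    (hmax : ∀ n, ∀ᵐ ω ∂P, ∀ x ∈ Metric.ball x₀ r,
      ∑ i ∈ Finset.range n, F (X i ω) x ≤ ∑ i ∈ Finset.range n, F (X i ω) (e n ω))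
    (hI : IsUnit (information μ F x₀)) :
    TendstoInDistribution (fun (n : ℕ) ω => √(n : ℝ) • (e n ω - x₀)) atTop id (fun _ => P)
      (multivariateGaussian 0 (information μ F x₀)⁻¹) := by
  have : IsProbabilityMeasure μ := (hlaw 0).isProbabilityMeasure_iff.1 inferInstance
  set S := information μ F x₀ with hS
  have hSpsd : S.PosSemidef := h.posSemidef_information hμ
  have hSdet : IsUnit S.det := (Matrix.isUnit_iff_isUnit_det S).1 hI
  -- Multiplying the estimating equation by `K = S⁻¹` normalizes the averaged Hessian to tend to
  -- `-1`.
  set K : EuclideanSpace ℝ ι →L[ℝ] EuclideanSpace ℝ ι := Matrix.toEuclideanCLM (𝕜 := ℝ) S⁻¹ with hK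
  have hKsymm : ∀ x y, inner ℝ (K x) y = inner ℝ x (K y) := by
    intro x y
    have hsymm : S⁻¹.transpose = S⁻¹ := by
      have := hSpsd.inv.isHermitian.eq
      rwa [Matrix.conjTranspose_eq_transpose_of_trivial] at this
    rw [real_inner_comm, hK, Matrix.inner_toEuclideanCLM, Matrix.inner_toEuclideanCLM,
      Matrix.dotProduct_mulVec, dotProduct_comm, ← Matrix.mulVec_transpose, hsymm]
  have hYmeas : Measurable fun t => K (score F x₀ t) :=
    K.continuous.measurable.comp h.measurable_score
  have hXm := fun i => (hlaw i).aemeasurable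
  have hmap : ∀ f : T → ℝ, Measurable f → ∫ ω, f (X 0 ω) ∂P = ∫ t, f t ∂μ := fun f hf => by
    rw [← (hlaw 0).map_eq, integral_map (hXm 0) hf.aestronglyMeasurable]
  have hinner : ∀ v, Measurable fun t => inner ℝ (score F x₀ t) v := fun v => by
    simp only [inner_score]
    exact h.measurable_fderiv_apply h.mem_ball v
  have hCLT := tendstoInDistribution_multivariateGaussian (P := P)
    (Y := fun i ω => K (score F x₀ (X i ω))) hSpsd.inv (hindep.comp _ fun _ => hYmeas)
    (fun i => IdentDistrib.comp (f := X i) (g := X 0)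
      ⟨hXm i, hXm 0, by rw [(hlaw i).map_eq, (hlaw 0).map_eq]⟩ hYmeas)
    (MemLp.of_bound (hYmeas.comp_aemeasurable (hXm 0)).aestronglyMeasurable (‖K‖ * C)
      (ae_of_all _ fun ω => K.le_of_opNorm_le_of_le le_rfl (h.norm_score_le _)))
    (fun t => by
      simp only [hKsymm]
      rw [hmap _ (hinner (K t))]
      exact h.integral_inner_score hμ _)
    -- The variance along `t` is that of the score along `S⁻¹ t`, namely `⟨S⁻¹ t, S S⁻¹ t⟩ = ⟨t, S⁻¹
    -- t⟩`.
    (fun t => by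
      simp only [hKsymm]
      rw [hmap _ ((hinner (K t)).pow_const 2), h.integral_inner_score_sq hμ, ← hS,
        ← Matrix.inner_toEuclideanCLM, hKsymm, hK, ← mul_apply_eq_comp, ← map_mul,
        Matrix.nonsing_inv_mul _ hSdet, map_one, one_apply_eq_self, ← hK,
        Matrix.inner_toEuclideanCLM])
  let Φ : Matrix ι ι ℝ →ₗ[ℝ] (EuclideanSpace ℝ ι →L[ℝ] EuclideanSpace ℝ ι) :=
    { toFun := fun A => K * Matrix.toEuclideanCLM (𝕜 := ℝ) A
      map_add' := fun A B => by rw [map_add, mul_add]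
      map_smul' := fun c A => by
        rw [map_smul, RingHom.id_apply]
        exact K.comp_smul c _ }
  have hΦ : Continuous Φ := Φ.continuous_of_finiteDimensional
  have hLLN := ae_tendsto_average_matrix h.measurable_hessian h.norm_hessian_le hindep hlaw
  refine tendstoInDistribution_of_linearized (C := ‖K‖ * C)
    (B := fun i ω => Φ (hessian F x₀ (X i ω))) hCLT ?_ (fun n => (he n).sub_const x₀) ?_ ?_
  · filter_upwards [hLLN] with ω hω
    have h1 := (hΦ.tendsto _).comp hω
    have h2 : Φ (Matrix.of fun i j => ∫ t, hessian F x₀ t i j ∂μ) = -1 := by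
      have h3 : (Matrix.of fun i j => ∫ t, hessian F x₀ t i j ∂μ) = -S := by
        ext i j
        simp [hS, information]
      rw [h3, map_neg]
      change -(K * Matrix.toEuclideanCLM (𝕜 := ℝ) S) = -1
      rw [hK, ← map_mul, Matrix.nonsing_inv_mul _ hSdet, map_one]
    rw [h2] at h1
    simpa [Function.comp_def] using h1
  · filter_upwards [hcons] with ω hω
    simpa using hω.sub_const x₀
  · filter_upwards [hcons, ae_all_iff.2 hmax] with ω hω hmω
    filter_upwards [hω (Metric.isOpen_ball.mem_nhds h.mem_ball)] with n hn
    -- Consistency puts `e n ω` in the open ball for large `n`, so it is a local maximum and its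
    -- total score vanishes.
    have hzero : ∑ i ∈ Finset.range n, score F (e n ω) (X i ω) = 0 := by
      have hloc : IsLocalMax (fun x => ∑ i ∈ Finset.range n, F (X i ω) x) (e n ω) := by
        filter_upwards [Metric.isOpen_ball.mem_nhds hn] with x hx using hmω n x hx
      have h1 := hloc.fderiv_eq_zero
      rw [fderiv_fun_sum fun i _ => h.differentiableAt _ hn] at h1
      simp only [score]
      rw [← map_sum, h1, map_zero]
    have hsum : ∑ i ∈ Finset.range n, K (score F x₀ (X i ω)) +
        (∑ i ∈ Finset.range n, Φ (hessian F x₀ (X i ω))) (e n ω - x₀) =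
        K (∑ i ∈ Finset.range n, (score F x₀ (X i ω) +
          Matrix.toEuclideanCLM (𝕜 := ℝ) (hessian F x₀ (X i ω)) (e n ω - x₀) -
          score F (e n ω) (X i ω))) := by
      rw [Finset.sum_sub_distrib, hzero, sub_zero, Finset.sum_add_distrib, map_add, map_sum,
        map_sum, sum_apply]
      rfl
    rw [hsum]
    refine (K.le_opNorm _).trans ?_
    rw [mul_assoc, mul_left_comm]
    gcongr
    refine (norm_sum_le_of_le _ fun i _ => h.norm_score_add_hessian_sub_le (X i ω) hn).trans ?_
    simp

end IsRegularLogDensity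

/-! ### The sine-skewed family is regular; proof of the theorem. -/

namespace ESS

variable {d : ℕ} {m : ℝ} {f₀ : ℝ → Shape d → ℝ} {M : Set ℝ} {R : Set (Shape d)} {δ : ℝ}

/-- Around an interior parameter, the extended sine-skewed family is regular. -/
theorem exists_isRegularLogDensity (hm : 0 ≤ m) (hδ : 0 < δ)
    (hf₀ : ∀ ρ ∈ R, IsCircularDensity fun θ => f₀ θ ρ) (hA1 : CondA1 f₀ R) (hA4 : CondA4 f₀ R)
    (hA5 : CondA5 f₀ M R) {η₀ : Param d} (hη₀ : η₀ ∈ interior (paramSpace M R δ))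
    (hp : IsProbabilityMeasure (law m f₀ η₀)) :
    ∃ r C, Metric.ball η₀ r ⊆ paramSpace M R δ ∧
      IsRegularLogDensity (volume.restrict (Ico (-Real.pi) Real.pi))
        (fun θ η => Real.log (density m f₀ η θ)) η₀ r C := by
  obtain ⟨a, ha, b, hab⟩ := exists_density_bounds (m := m) (M := M) hm hδ hf₀ hA4
  have hpos : ∀ η ∈ paramSpace M R δ, ∀ θ, 0 < density m f₀ η θ :=
    fun η hη θ => ha.trans_le (hab η hη θ).1
  obtain ⟨r, hr, hrH, hsm, C, hC⟩ := exists_ball_log_density hm hδ hf₀ hA4 hA5 hη₀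
  have hη₀' := interior_subset hη₀
  refine ⟨r, C, hrH, hr, hsm, hC, fun η hη => ?_, fun η hη => ?_⟩
  · exact ((continuous_density hm hA1 (hrH hη).2.1).log
      fun θ => (hpos η (hrH hη) θ).ne').measurable
  · simp only [Real.exp_log (hpos η (hrH hη) _)]
    rw [integral_Ico_eq_integral_Ioc,
      ← intervalIntegral.integral_of_le (by linarith [Real.pi_pos]),
      integral_density hm hf₀ hA1 (hrH hη).2.1]
    exact G_one_of_isProbabilityMeasure hm hf₀ hA1 hη₀'.2.1 (fun θ => (hpos _ hη₀' θ).le) hp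

end ESS

theorem theorem1 {d : ℕ} (m : ℝ) (hm : 0 ≤ m)
    -- base densities and parameter spaces
    (f₀ : ℝ → ESS.Shape d → ℝ) (M : Set ℝ) (R : Set (ESS.Shape d)) (δ : ℝ) (hδ : 0 < δ)
    (hM : M ⊆ Ico (-Real.pi) Real.pi)
    (hf₀ : ∀ ρ ∈ R, ESS.IsCircularDensity (fun θ => f₀ θ ρ))
    -- common regularity conditions
    (hA1 : ESS.CondA1 f₀ R) (hA2 : ESS.CondA2 f₀ R) (hA4 : ESS.CondA4 f₀ R)
    (hA7 : ESS.CondA7 m f₀ (ESS.paramSpace M R δ))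
    -- an i.i.d. sample from the model with true parameter `η₀`
    (η₀ : ESS.Param d) {Ω : Type*} [MeasurableSpace Ω] (P : Measure Ω) [IsProbabilityMeasure P]
    (Θ : ℕ → Ω → ℝ) (hindep : iIndepFun Θ P) (hlaw : ∀ i, HasLaw (Θ i) (ESS.law m f₀ η₀) P)
    -- maximum likelihood estimators
    (ηhat : ℕ → Ω → ESS.Param d) (hmeas : ∀ n, AEMeasurable (ηhat n) P)
    (hMLE : ∀ n, ∀ᵐ ω ∂P,
      ESS.IsMLE m f₀ (ESS.paramSpace M R δ) (fun i => Θ i ω) n (ηhat n ω)) :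
    -- consistency
    ((IsCompact (ESS.paramSpace M R δ) ∧ η₀ ∈ ESS.paramSpace M R δ) →
      (∀ θ : ℝ, ContinuousOn (fun p : ℝ × ESS.Shape d => f₀ (θ - p.1) p.2) (M ×ˢ R)) →
      TendstoInMeasure P ηhat atTop (fun _ => η₀)) ∧
    -- asymptotic normality
    ((Convex ℝ (ESS.paramSpace M R δ) ∧ IsCompact (ESS.paramSpace M R δ) ∧
        η₀ ∈ interior (ESS.paramSpace M R δ)) →
      ESS.CondA5 f₀ M R →
      IsUnit (ESS.fisherInfo m f₀ η₀) →
      TendstoInDistribution (fun (n : ℕ) ω => Real.sqrt (n : ℝ) • (ηhat n ω - η₀)) atTop id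
        (fun _ => P) (multivariateGaussian 0 (ESS.fisherInfo m f₀ η₀)⁻¹)) := by
  have hAE := ESS.ae_tendsto_mle hm hδ hf₀ hA1 hA4 hA7 hindep hlaw hMLE
  constructor
  · rintro ⟨hcomp, hη₀⟩ hcont
    exact tendstoInMeasure_of_tendsto_ae (fun n => (hmeas n).aestronglyMeasurable)
      (hAE hcomp hη₀ hcont)
  · rintro ⟨-, hcomp, hint⟩ hA5 hI
    have hη₀ := interior_subset hint
    obtain ⟨r, C, hrH, hreg⟩ := ESS.exists_isRegularLogDensity hm hδ hf₀ hA1 hA4 hA5 hint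
      ((hlaw 0).isProbabilityMeasure_iff.1 inferInstance)
    obtain ⟨a, ha, b, hab⟩ := ESS.exists_density_bounds (m := m) (M := M) hm hδ hf₀ hA4
    -- `fisherInfo` unfolds to `information` of this family, so `hI` and the limit covariance match
    -- definitionally.
    refine hreg.tendstoInDistribution_maximizer (fun f => ?_) hindep hlaw hmeas
      (hAE hcomp hη₀ fun θ => (hA5.1 θ).continuousOn) (fun n => ?_) hI
    · have hpos := fun θ => ha.trans_le (hab η₀ hη₀ θ).1
      rw [ESS.integral_law hm hA1 hη₀.2.1 fun θ => (hpos θ).le]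
      simp only [Real.exp_log (hpos _)]
    · filter_upwards [hMLE n] with ω hω x hx
      have h := hω.2 x (hrH hx)
      rw [ESS.logLik_eq hm hδ hf₀ hA4 _ _ (hrH hx), ESS.logLik_eq hm hδ hf₀ hA4 _ _ hω.1] at h
      -- At `n = 0` the factor `(n : ℝ)⁻¹` is `0` and cannot be cancelled, but both sums are empty.
      rcases n.eq_zero_or_pos with rfl | hn
      · simp
      · exact le_of_mul_le_mul_left h (by positivity)
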